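/- Let $\Omega\subset\mathbb R^2$ be a bounded, open, connected set with smooth boundary, of area $|\Omega|$. A hole of $\Omega$ is a bounded connected component of $\mathbb R^2\setminus\Omega$. Assume that $\Omega$ is doubly connected, i.e. that it has exactly one hole. Let $h(\Omega)$ be the least length of a segment $\Gamma$ such that $\Omega\setminus\Gamma$ is simply connected (in general, the least total length of $n$ segments, $n$ being the number of holes, whose removal makes $\Omega$ simply connected), and let $\beta(\Omega)$ be the minimal width of $\Omega$, i.e. the distance between its inner and its outer boundary component. For a real closed $1$-form $A$ on $\Omega$, smooth up to the boundary, let $$\lambda_1(\Omega,A)=\inf\Big\{\frac{\int_\Omega|\nabla u-iuA^\sharp|^2}{\int_\Omega|u|^2}\;:\;u\in H^1(\Omega,\mathbb C)\setminus\{0\}\Big\}$$ be the lowest eigenvalue of the magnetic Laplacian on $\Omega$ with magnetic Neumann boundary conditions, where $A^\sharp$ is the vector field dual to $A$. Then the minimum $h(\Omega)$ is attained, it is positive, and $h(\Omega)=\beta(\Omega)$. If moreover $h(\Omega)\le\min\{1,\tfrac{|\Omega|}{2\pi}\}$, then for every such $A$ $$\lambda_1(\Omega,A)\le\frac{8\pi}{|\Omega|\,\big|\ln\frac{h(\Omega)}{2}\big|}.$$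 Consequently, if $(\Omega_k)$ is a sequence of such domains, all of the same area, with $\beta(\Omega_k)\to0$, and $A_k$ is a closed $1$-form on $\Omega_k$, smooth up to the boundary, then $\lambda_1(\Omega_k,A_k)\to0$. -/

import Mathlib

open MeasureTheory Filter Topology
open scoped ContDiff

namespace MagneticPlane

/-- The Euclidean plane `ℝ²`. -/
abbrev Plane : Type := EuclideanSpace ℝ (Fin 2)

/-- The standard basis vectors of the plane. -/
noncomputable def e (i : Fin 2) : Plane := EuclideanSpace.single i 1

/-! ### Domains, holes, cuts -/

/-- `Ω` has smooth boundary: near each boundary point, `Ω` is the sublevel set `{ρ < 0}` of a smooth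
function `ρ` without critical points. -/
def HasSmoothBoundary (Ω : Set Plane) : Prop :=
  ∀ x ∈ frontier Ω, ∃ (V : Set Plane) (ρ : Plane → ℝ), IsOpen V ∧ x ∈ V ∧
    ContDiffOn ℝ ∞ ρ V ∧ (∀ y ∈ V, fderiv ℝ ρ y ≠ 0) ∧ Ω ∩ V = {y ∈ V | ρ y < 0}

/-- The holes of `Ω`: the bounded connected components of the complement of `Ω`. -/
def holes (Ω : Set Plane) : Set (Set Plane) :=
  {C | Bornology.IsBounded C ∧ ∃ x ∈ Ωᶜ, C = connectedComponentIn Ωᶜ x}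

/-- The number of holes of `Ω`. -/
noncomputable def numHoles (Ω : Set Plane) : ℕ := (holes Ω).ncard

/-- `Ω` is a bounded, doubly connected plane domain with smooth boundary. -/
structure IsDoublyConnectedDomain (Ω : Set Plane) : Prop where
  isOpen : IsOpen Ω
  isConnected : IsConnected Ω
  isBounded : Bornology.IsBounded Ω
  smoothBoundary : HasSmoothBoundary Ω
  one_hole : numHoles Ω = 1

/-- The total lengths of the admissible cuts of `Ω`: an admissible cut is a family of `n` segments,
`n` being the number of holes, whose removal makes `Ω` simply connected. -/
def cutLengths (Ω : Set Plane) : Set ℝ :=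
  {l | ∃ p q : Fin (numHoles Ω) → Plane,
    IsSimplyConnected (Ω \ ⋃ j, segment ℝ (p j) (q j)) ∧ l = ∑ j, dist (p j) (q j)}

/-- The Cheeger type constant `h(Ω)`: the least total length of an admissible cut. -/
noncomputable def cheegerCut (Ω : Set Plane) : ℝ := sInf (cutLengths Ω)

/-- The inner boundary of `Ω`: the boundary of the union of the holes. -/
def innerBoundary (Ω : Set Plane) : Set Plane := frontier (⋃₀ holes Ω)

/-- The outer boundary of `Ω`: the boundary of the unbounded part of the complement. -/
def outerBoundary (Ω : Set Plane) : Set Plane := frontier (Ωᶜ \ ⋃₀ holes Ω)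

/-- The minimal width `β(Ω)`: the distance between the inner and the outer boundary. -/
noncomputable def minWidth (Ω : Set Plane) : ℝ :=
  sInf {d | ∃ x ∈ innerBoundary Ω, ∃ y ∈ outerBoundary Ω, d = dist x y}

/-- The area of `Ω`. -/
noncomputable def area (Ω : Set Plane) : ℝ := (volume Ω).toReal

/-! ### Closed potentials and the magnetic Rayleigh quotient -/

/-- `A` is a closed one-form on `Ω`, smooth up to the boundary. -/
def IsClosedPotential (Ω : Set Plane) (A : Plane → (Plane →L[ℝ] ℝ)) : Prop :=
  ContDiffOn ℝ ∞ A (closure Ω) ∧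
    ∀ x ∈ Ω, ∀ v w : Plane, fderiv ℝ A x v w = fderiv ℝ A x w v

/-- `g` is the weak `i`-th partial derivative of `u` on `Ω`. -/
def IsWeakPartial (Ω : Set Plane) (i : Fin 2) (u g : Plane → ℂ) : Prop :=
  ∀ φ : Plane → ℝ, ContDiff ℝ ∞ φ → HasCompactSupport φ → tsupport φ ⊆ Ω →
    ∫ x in Ω, (fderiv ℝ φ x (e i) : ℂ) * u x = -∫ x in Ω, (φ x : ℂ) * g x

/-- `u` belongs to `H¹(Ω, ℂ)` and has weak gradient `(g 0, g 1)`. -/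
def IsH1WithGradient (Ω : Set Plane) (u : Plane → ℂ) (g : Fin 2 → Plane → ℂ) : Prop :=
  MemLp u 2 (volume.restrict Ω) ∧
    ∀ i, MemLp (g i) 2 (volume.restrict Ω) ∧ IsWeakPartial Ω i u (g i)

/-- The magnetic energy `∫_Ω |∇u - i u A|²` of a function `u` with weak gradient `g`. -/
noncomputable def magneticEnergy (Ω : Set Plane) (A : Plane → (Plane →L[ℝ] ℝ))
    (u : Plane → ℂ) (g : Fin 2 → Plane → ℂ) : ℝ :=
  ∫ x in Ω, ∑ i, ‖g i x - Complex.I * (A x (e i) : ℂ) * u x‖ ^ 2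

/-- The values of the magnetic Rayleigh quotient on `H¹(Ω, ℂ) \ {0}`. -/
def rayleighQuotients (Ω : Set Plane) (A : Plane → (Plane →L[ℝ] ℝ)) : Set ℝ :=
  {r | ∃ (u : Plane → ℂ) (g : Fin 2 → Plane → ℂ), IsH1WithGradient Ω u g ∧
    ¬ (u =ᵐ[volume.restrict Ω] 0) ∧
    r = magneticEnergy Ω A u g / ∫ x in Ω, ‖u x‖ ^ 2}

/-- The ground state energy `λ₁(Ω, A)` of the magnetic Neumann Laplacian. -/
noncomputable def groundState (Ω : Set Plane) (A : Plane → (Plane →L[ℝ] ℝ)) : ℝ :=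
  sInf (rayleighQuotients Ω A)

end MagneticPlane

/-! The complement of a doubly connected `Ω` is the disjoint union of the compact hole `K` and an
unbounded closed connected set `U`. Let `[p, q]` be a shortest segment between `K` and `U`; its
interior lies in `Ω`. Removing it leaves a connected set (`isPreconnected_diff_segment`), and its
complement `K ∪ [p, q] ∪ U` is connected, so the cut domain is simply connected
(`isSimplyConnected_of_isPreconnected_compl`). Conversely, a cut missing `K` or `U` would leave a
simply connected open set surrounding a compact set, which the winding of `z - p` forbids
(`false_of_isSimplyConnected_of_surround`). So every admissible segment meets both `K` and `U` and
is at least `dist p q` long; hence `h = β = dist p q > 0`.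

For the eigenvalue, a closed `A` has a primitive `ψ` on the cut domain, and `exp (iψ)` has zero
magnetic energy there. Multiplied by a radial logarithmic cut-off that vanishes near the disc of
radius `h / 2` about the midpoint of the cut, it becomes a test function on all of `Ω`. Only the
gradient of the cut-off contributes energy, at most `6π / ℓ` with `ℓ = |log (h / 2)|`, and the mass
is at least `3/4` of the area (`groundState_le_of_phase`). The limit statement follows because `ℓ →
∞` when `β → 0`.

The topological core is `exists_local_potential`: a cocycle on `W` is discretised on a fine grid,
and its failure to be flat near the connected complement is pushed out of a large box, square by
square. Applied to path holonomy it kills the fundamental group. -/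

namespace MagneticPlane

/-! ### Flat edge labellings of the square grid -/

section Grid

variable {G : Type*} [Group G]

/-- The labels `h` of the horizontal and `v` of the vertical grid edges multiply to one around the
square with lower left corner `s`. -/
def FlatAt (h v : ℤ → ℤ → G) (s : ℤ × ℤ) : Prop :=
  h s.1 s.2 * v (s.1 + 1) s.2 = v s.1 s.2 * h s.1 (s.2 + 1)

/-- Two grid squares share an edge. -/
def EdgeAdj (s t : ℤ × ℤ) : Prop :=
  t = (s.1 + 1, s.2) ∨ t = (s.1 - 1, s.2) ∨ t = (s.1, s.2 + 1) ∨ t = (s.1, s.2 - 1)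

/-- Two edge labellings agree on the edges of the squares in `F`. -/
def AgreeOn (F : Set (ℤ × ℤ)) (h v h' v' : ℤ → ℤ → G) : Prop :=
  ∀ s ∈ F, h' s.1 s.2 = h s.1 s.2 ∧ h' s.1 (s.2 + 1) = h s.1 (s.2 + 1) ∧
    v' s.1 s.2 = v s.1 s.2 ∧ v' (s.1 + 1) s.2 = v (s.1 + 1) s.2

lemma AgreeOn.flatAt {F : Set (ℤ × ℤ)} {h v h' v' : ℤ → ℤ → G} (H : AgreeOn F h v h' v')
    {s : ℤ × ℤ} (hs : s ∈ F) (hf : FlatAt h v s) : FlatAt h' v' s := by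
  obtain ⟨h1, h2, h3, h4⟩ := H s hs
  rw [FlatAt, h1, h2, h3, h4]
  exact hf

/-- A square can be made flat by changing the label of an edge that it shares with a free square. -/
lemma exists_flatAt_of_edgeAdj (F : Set (ℤ × ℤ)) {s t : ℤ × ℤ} (hs : s ∉ F) (ht : t ∉ F)
    (hst : EdgeAdj s t) (h v : ℤ → ℤ → G) :
    ∃ h' v' : ℤ → ℤ → G, AgreeOn F h v h' v' ∧ FlatAt h' v' s := by
  classical
  obtain ⟨a, b⟩ := s
  rcases hst with rfl | rfl | rfl | rfl
  -- An edge borders only the two squares on its sides. Both are outside `F`, so its label is free,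
  -- and the flatness equation of `s` is solved for it. The four cases are the right, left, upper
  -- and lower neighbour.
  · refine ⟨h, fun i j => if i = a + 1 ∧ j = b then (h a b)⁻¹ * (v a b * h a (b + 1)) else v i j,
      ?_, ?_⟩
    · rintro ⟨i, j⟩ hij
      refine ⟨rfl, rfl, if_neg ?_, if_neg ?_⟩
      · rintro ⟨rfl, rfl⟩; exact ht hij
      · rintro ⟨h1, rfl⟩; obtain rfl : i = a := by simpa using h1
        exact hs hij
    · simp [FlatAt]
  · refine ⟨h, fun i j => if i = a ∧ j = b then h a b * v (a + 1) b * (h a (b + 1))⁻¹ else v i j,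
      ?_, ?_⟩
    · rintro ⟨i, j⟩ hij
      refine ⟨rfl, rfl, if_neg ?_, if_neg ?_⟩
      · rintro ⟨rfl, rfl⟩; exact hs hij
      · rintro ⟨h1, rfl⟩; obtain rfl : i = a - 1 := by simp at h1; omega
        exact ht hij
    · simp [FlatAt]
  · refine ⟨fun i j => if i = a ∧ j = b + 1 then (v a b)⁻¹ * (h a b * v (a + 1) b) else h i j, v,
      ?_, ?_⟩
    · rintro ⟨i, j⟩ hij
      refine ⟨if_neg ?_, if_neg ?_, rfl, rfl⟩
      · rintro ⟨rfl, rfl⟩; exact ht hij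
      · rintro ⟨rfl, h1⟩; obtain rfl : j = b := by simpa using h1
        exact hs hij
    · simp [FlatAt]
  · refine ⟨fun i j => if i = a ∧ j = b then v a b * h a (b + 1) * (v (a + 1) b)⁻¹ else h i j, v,
      ?_, ?_⟩
    · rintro ⟨i, j⟩ hij
      refine ⟨if_neg ?_, if_neg ?_, rfl, rfl⟩
      · rintro ⟨rfl, rfl⟩; exact hs hij
      · rintro ⟨rfl, h1⟩; obtain rfl : j = b - 1 := by simp at h1; omega
        exact ht hij
    · simp [FlatAt]

/-- A labelling that is flat on `F` can be changed off `F` so that it becomes flat on the finite set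
`R` too, if every square of `R` has a neighbour off `F` that has a smaller rank. -/
lemma exists_flat_extension (d : ℤ × ℤ → ℕ) (π : ℤ × ℤ → ℤ × ℤ) (R : Finset (ℤ × ℤ)) :
    ∀ F : Set (ℤ × ℤ), (∀ s ∈ R, s ∉ F ∧ π s ∉ F ∧ EdgeAdj s (π s) ∧ d (π s) < d s) →
      ∀ h v : ℤ → ℤ → G, (∀ s ∈ F, FlatAt h v s) →
        ∃ h' v' : ℤ → ℤ → G, AgreeOn F h v h' v' ∧ ∀ s, s ∈ F ∨ s ∈ R → FlatAt h' v' s := by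
  classical
  -- The square of largest rank is repaired first and then frozen. The edge that a remaining square
  -- changes leads to a square of strictly smaller rank, hence never to a frozen one.
  induction R using Finset.induction_on_max_value d with
  | empty =>
    intro F _ h v hF
    exact ⟨h, v, fun s _ => ⟨rfl, rfl, rfl, rfl⟩, by simpa using hF⟩
  | insert a R ha hmax ih =>
    intro F hR h v hF
    obtain ⟨haF, hpF, hadj, -⟩ := hR a (Finset.mem_insert_self a R)
    obtain ⟨h₁, v₁, hag, hfl⟩ := exists_flatAt_of_edgeAdj F haF hpF hadj h v
    obtain ⟨h₂, v₂, hag₂, hfl₂⟩ := ih (insert a F) (by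
      intro s hs
      obtain ⟨h1, h2, h3, h4⟩ := hR s (Finset.mem_insert_of_mem hs)
      refine ⟨?_, ?_, h3, h4⟩
      · rintro (rfl | hs'); exacts [ha hs, h1 hs']
      · rintro (hs' | hs')
        · have := hmax s hs
          rw [hs'] at h4
          omega
        · exact h2 hs') h₁ v₁ (by
      rintro s (rfl | hs); exacts [hfl, hag.flatAt hs (hF s hs)])
    refine ⟨h₂, v₂, fun s hs => ?_, fun s hs => hfl₂ s ?_⟩
    · obtain ⟨a1, a2, a3, a4⟩ := hag s hs
      obtain ⟨b1, b2, b3, b4⟩ := hag₂ s (Or.inr hs)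
      exact ⟨b1.trans a1, b2.trans a2, b3.trans a3, b4.trans a4⟩
    · rcases hs with hs | hs
      · exact Or.inl (Or.inr hs)
      · rcases Finset.mem_insert.1 hs with rfl | hs
        exacts [Or.inl (Or.inl rfl), Or.inr hs]

/-- If a target is reachable from `s` along `r`, there is a first step that decreases the
distance to the target. -/
lemma exists_rank {α : Type*} (r : α → α → Prop) (T : Set α) :
    ∃ (d : α → ℕ) (π : α → α), ∀ s, s ∉ T → (∃ t ∈ T, Relation.ReflTransGen r s t) →
      r s (π s) ∧ d (π s) < d s := by
  classical
  -- `L n` consists of the points with an `n`-step path into `T`, and `d` is the least such `n`; `π`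
  -- steps to a point with smaller `d`. The default values at points that cannot reach `T` play no
  -- role.
  let L : ℕ → Set α := fun n => Nat.rec (motive := fun _ => Set α) T (fun _ S => {s | ∃ t ∈ S, r s t}) n
  have hL : ∀ s, (∃ t ∈ T, Relation.ReflTransGen r s t) → ∃ n, s ∈ L n := by
    rintro s ⟨t, ht, hst⟩
    induction hst using Relation.ReflTransGen.head_induction_on with
    | refl => exact ⟨0, ht⟩
    | head h _ ih => obtain ⟨n, hn⟩ := ih; exact ⟨n + 1, _, hn, h⟩
  let d : α → ℕ := fun s => if h : ∃ n, s ∈ L n then Nat.find h else 0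
  have key : ∀ s, s ∉ T → (∃ t ∈ T, Relation.ReflTransGen r s t) → ∃ t, r s t ∧ d t < d s := by
    intro s hs hr
    have h := hL s hr
    have hd : d s = Nat.find h := dif_pos h
    have hm := Nat.find_spec h
    rw [← hd] at hm
    rcases hn : d s with _ | n
    · rw [hn] at hm; exact absurd hm hs
    · rw [hn] at hm
      obtain ⟨t, ht, hst⟩ := hm
      have h' : ∃ n, t ∈ L n := ⟨n, ht⟩
      refine ⟨t, hst, ?_⟩
      have : d t = Nat.find h' := dif_pos h'
      rw [this]
      exact Nat.lt_succ_of_le (Nat.find_min' h' ht)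
  refine ⟨d, fun s => if h : ∃ t, r s t ∧ d t < d s then h.choose else s, fun s hs hr => ?_⟩
  have h := key s hs hr
  simp only [dif_pos h]
  exact h.choose_spec

/-- A labelling that is flat on a box is the coboundary of a vertex labelling. -/
lemma exists_vertex_potential (h v : ℤ → ℤ → G) (M : ℕ)
    (hf : ∀ i j : ℕ, i < M → j < M → FlatAt h v (i, j)) :
    ∃ b : ℤ → ℤ → G, (∀ i j : ℕ, b i (j + 1) = b i j * v i j) ∧
      ∀ i j : ℕ, i < M → j ≤ M → b (i + 1) j = b i j * h i j := by
  -- Labels are multiplied along the bottom row and then up the column. The vertical relations hold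
  -- by construction; flatness carries the horizontal ones from each row to the next.
  let row : ℕ → G := fun n => Nat.rec 1 (fun k g => g * h k 0) n
  let col : ℕ → ℕ → G := fun i n => Nat.rec (row i) (fun k g => g * v i k) n
  have hrow : ∀ i, row (i + 1) = row i * h i 0 := fun i => rfl
  have hcol0 : ∀ i, col i 0 = row i := fun i => rfl
  have hcol : ∀ i j, col i (j + 1) = col i j * v i j := fun i j => rfl
  refine ⟨fun i j => col i.toNat j.toNat, fun i j => ?_, fun i j hi hj => ?_⟩
  · have : ((j : ℤ) + 1).toNat = j + 1 := by omega
    simp only [this, Int.toNat_natCast, hcol]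
  · have : ((i : ℤ) + 1).toNat = i + 1 := by omega
    simp only [this, Int.toNat_natCast]
    induction j with
    | zero => simp [hcol0, hrow]
    | succ j ih =>
      have := hf i j hi (by omega)
      simp only [FlatAt] at this
      rw [hcol (i + 1), ih (by omega), hcol i]
      push_cast
      rw [mul_assoc, this, mul_assoc]

end Grid

/-! ### Cocycles on plane sets with connected complement -/

lemma dist_lt_of_sq_lt {x y : Plane} {r : ℝ} (hr : 0 < r)
    (h : (x 0 - y 0) ^ 2 + (x 1 - y 1) ^ 2 < r ^ 2) : dist x y < r := by
  rw [EuclideanSpace.dist_eq, Real.sqrt_lt' hr]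
  simpa [Fin.sum_univ_two, Real.dist_eq, sq_abs] using h

lemma abs_coord_sub_le_dist (x y : Plane) (i : Fin 2) : |x i - y i| ≤ dist x y := by
  rw [dist_eq_norm]
  simpa using PiLp.norm_apply_le (x - y) i

/-- A group valued cocycle `c x y`, defined for pairs of close points of a bounded open set `W` of the
plane with connected complement, is a coboundary near every compact subset of `W`. -/
theorem exists_local_potential {G : Type*} [Group G] {W X : Set Plane}
    (hWb : Bornology.IsBounded W) (hWo : IsOpen W) (hWc : IsPreconnected Wᶜ)
    (hX : IsCompact X) (hXW : X ⊆ W) (c : Plane → Plane → G)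
    (hc : ∀ (p : Plane) (r : ℝ), Metric.ball p r ⊆ W → ∀ x ∈ Metric.ball p r,
      ∀ y ∈ Metric.ball p r, ∀ z ∈ Metric.ball p r, c x y * c y z = c x z) :
    ∃ b : Plane → G, ∃ δ > 0, ∀ x ∈ X, ∀ y ∈ X, dist x y < δ → c x y = (b x)⁻¹ * b y := by
  classical
  obtain ⟨η, hη, hηW⟩ := hX.exists_thickening_subset_open hWo hXW
  -- `ε` is the mesh of the grid. The generous factor 20 keeps in `W` every point whose coordinates
  -- differ by at most `4ε` from those of a point of `X`.
  obtain ⟨ε, hε, rfl⟩ : ∃ ε : ℝ, 0 < ε ∧ η = 20 * ε := ⟨η / 20, by positivity, by ring⟩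
  obtain ⟨R, hR, hWR⟩ : ∃ R : ℝ, 0 < R ∧ ∀ x ∈ W, ‖x‖ < R := by
    obtain ⟨R, hR⟩ := hWb.exists_norm_le
    exact ⟨max R 0 + 1, by positivity, fun x hx =>
      ((hR x hx).trans (le_max_left _ _)).trans_lt (lt_add_one _)⟩
  let V : ℤ → ℤ → Plane := fun i j => !₂[ε * i - R, ε * j - R]
  have hV0 : ∀ i j, V i j 0 = ε * i - R := fun i j => rfl
  have hV1 : ∀ i j, V i j 1 = ε * j - R := fun i j => rfl
  let φ : Plane → ℤ × ℤ := fun x => (⌊(x 0 + R) / ε⌋, ⌊(x 1 + R) / ε⌋)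
  have hφ0 : ∀ x, ε * (φ x).1 ≤ x 0 + R ∧ x 0 + R < ε * ((φ x).1 + 1) := fun x =>
    ⟨by have := Int.floor_le ((x 0 + R) / ε); rw [le_div_iff₀ hε] at this; linarith,
      by have := Int.lt_floor_add_one ((x 0 + R) / ε); rw [div_lt_iff₀ hε] at this; linarith⟩
  have hφ1 : ∀ x, ε * (φ x).2 ≤ x 1 + R ∧ x 1 + R < ε * ((φ x).2 + 1) := fun x =>
    ⟨by have := Int.floor_le ((x 1 + R) / ε); rw [le_div_iff₀ hε] at this; linarith,
      by have := Int.lt_floor_add_one ((x 1 + R) / ε); rw [div_lt_iff₀ hε] at this; linarith⟩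
  have hφV : ∀ i j, φ (V i j) = (i, j) := by
    intro i j
    simp only [φ, hV0, hV1, sub_add_cancel, mul_div_cancel_left₀ _ hε.ne', Int.floor_intCast]
  have icast : ∀ {a b : ℤ}, ε * a < ε * (b + 2) → a ≤ b + 1 := by
    intro a b h
    have := lt_of_mul_lt_mul_left h hε.le
    have : a < b + 2 := by exact_mod_cast this
    omega
  have hφd : ∀ x y : Plane, dist x y < ε →
      |(φ x).1 - (φ y).1| ≤ 1 ∧ |(φ x).2 - (φ y).2| ≤ 1 := by
    intro x y hxy
    have h0 := abs_lt.1 ((abs_coord_sub_le_dist x y 0).trans_lt hxy)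
    have h1 := abs_lt.1 ((abs_coord_sub_le_dist x y 1).trans_lt hxy)
    have a0 := hφ0 x; have a1 := hφ1 x; have b0 := hφ0 y; have b1 := hφ1 y
    constructor <;> rw [abs_le] <;> constructor
    · have := @icast (φ y).1 (φ x).1 (by linarith); omega
    · have := @icast (φ x).1 (φ y).1 (by linarith); omega
    · have := @icast (φ y).2 (φ x).2 (by linarith); omega
    · have := @icast (φ x).2 (φ y).2 (by linarith); omega
  -- `C` consists of the squares meeting the complement, `N` of these and their eight neighbours.
  -- Off `N` a whole disc about the square lies in `W`, so the cocycle identity applies there.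
  let C : Set (ℤ × ℤ) := {s | ∃ x ∈ Wᶜ, φ x = s}
  let N : Set (ℤ × ℤ) := {s | ∃ t ∈ C, |s.1 - t.1| ≤ 1 ∧ |s.2 - t.2| ≤ 1}
  have hCN : C ⊆ N := fun s hs => ⟨s, hs, by simp, by simp⟩
  obtain ⟨M, hM⟩ := exists_nat_gt (2 * R / ε)
  rw [div_lt_iff₀ hε] at hM
  let T : Set (ℤ × ℤ) := {s | ¬ ((0 ≤ s.1 ∧ s.1 < M) ∧ (0 ≤ s.2 ∧ s.2 < M))}
  have hTC : T ⊆ C := by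
    rintro ⟨i, j⟩ hs
    refine ⟨V i j, fun hW => hs ?_, hφV i j⟩
    have hn := hWR _ hW
    have h0 := abs_lt.1 ((PiLp.norm_apply_le (V i j) 0).trans_lt hn)
    have h1 := abs_lt.1 ((PiLp.norm_apply_le (V i j) 1).trans_lt hn)
    rw [hV0] at h0; rw [hV1] at h1
    have aux : ∀ k : ℤ, -R < ε * k - R ∧ ε * k - R < R → 0 ≤ k ∧ k < M := by
      intro k hk
      constructor
      · have : 0 < ε * (k : ℝ) := by linarith [hk.1]
        have : (0 : ℝ) < k := pos_of_mul_pos_right this hε.le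
        exact_mod_cast this.le
      · have : ε * (k : ℝ) < ε * M := by linarith [hk.2]
        have := lt_of_mul_lt_mul_left this hε.le
        exact_mod_cast this
    exact ⟨aux i h0, aux j h1⟩
  -- the cocycle is flat on the squares off `N`
  have hflat : ∀ s ∈ Nᶜ, FlatAt (fun i j => c (V i j) (V (i + 1) j))
      (fun i j => c (V i j) (V i (j + 1))) s := by
    rintro ⟨i, j⟩ hs
    let m : Plane := !₂[ε * (i + 1 / 2) - R, ε * (j + 1 / 2) - R]
    have hm0 : m 0 = ε * (i + 1 / 2) - R := rfl
    have hm1 : m 1 = ε * (j + 1 / 2) - R := rfl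
    have hmW : Metric.ball m ε ⊆ W := by
      intro z hz
      by_contra hzW
      refine hs ⟨φ z, ⟨z, hzW, rfl⟩, ?_⟩
      rw [Metric.mem_ball] at hz
      have h0 := abs_lt.1 ((abs_coord_sub_le_dist z m 0).trans_lt hz)
      have h1 := abs_lt.1 ((abs_coord_sub_le_dist z m 1).trans_lt hz)
      rw [hm0] at h0; rw [hm1] at h1
      have a0 := hφ0 z; have a1 := hφ1 z
      constructor <;> rw [abs_le] <;> constructor
      · have := @icast (φ z).1 i (by linarith); simp only; omega
      · have := @icast i (φ z).1 (by linarith); simp only; omega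
      · have := @icast (φ z).2 j (by linarith); simp only; omega
      · have := @icast j (φ z).2 (by linarith); simp only; omega
    have hmem : ∀ a b : ℤ, (a = i ∨ a = i + 1) → (b = j ∨ b = j + 1) →
        V a b ∈ Metric.ball m ε := by
      intro a b ha hb
      rw [Metric.mem_ball]
      refine dist_lt_of_sq_lt hε ?_
      rw [hV0, hV1, hm0, hm1]
      have e1 : (ε * a - R - (ε * (i + 1 / 2) - R)) ^ 2 = ε ^ 2 / 4 := by
        rcases ha with rfl | rfl <;> push_cast <;> ring
      have e2 : (ε * b - R - (ε * (j + 1 / 2) - R)) ^ 2 = ε ^ 2 / 4 := by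
        rcases hb with rfl | rfl <;> push_cast <;> ring
      rw [e1, e2]
      nlinarith [pow_pos hε 2]
    simp only [FlatAt]
    rw [hc m ε hmW _ (hmem _ _ (.inl rfl) (.inl rfl)) _ (hmem _ _ (.inr rfl) (.inl rfl)) _
        (hmem _ _ (.inr rfl) (.inr rfl)),
      hc m ε hmW _ (hmem _ _ (.inl rfl) (.inl rfl)) _ (hmem _ _ (.inl rfl) (.inr rfl)) _
        (hmem _ _ (.inr rfl) (.inr rfl))]
  -- `N` is connected through edges
  let r : ℤ × ℤ → ℤ × ℤ → Prop := fun s t => s ∈ N ∧ t ∈ N ∧ EdgeAdj s t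
  have hrsymm : ∀ s t, r s t → r t s := by
    rintro ⟨a, b⟩ ⟨a', b'⟩ ⟨h1, h2, h3⟩
    refine ⟨h2, h1, ?_⟩
    simp only [EdgeAdj, Prod.mk.injEq] at h3 ⊢
    omega
  have hRsymm : ∀ s t, Relation.ReflTransGen r s t → Relation.ReflTransGen r t s := by
    have : Std.Symm r := ⟨hrsymm⟩
    exact fun s t h => Std.Symm.symm _ _ h
  have hblock : ∀ t ∈ C, ∀ a b : ℤ, |a| ≤ 1 → |b| ≤ 1 →
      Relation.ReflTransGen r t (t.1 + a, t.2 + b) := by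
    rintro ⟨p, q⟩ ht a b ha hb
    have hN : ∀ a b : ℤ, |a| ≤ 1 → |b| ≤ 1 → (p + a, q + b) ∈ N := fun a b ha hb =>
      ⟨_, ht, by simpa using ha, by simpa using hb⟩
    have s1 : Relation.ReflTransGen r (p, q) (p + a, q) := by
      by_cases h : a = 0
      · subst h; simpa using Relation.ReflTransGen.refl
      · refine .single ⟨hCN ht, by simpa using hN a 0 ha (by simp), ?_⟩
        rw [abs_le] at ha
        have : a = 1 ∨ a = -1 := by omega
        rcases this with rfl | rfl <;> simp [EdgeAdj, sub_eq_add_neg]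
    have s2 : Relation.ReflTransGen r (p + a, q) (p + a, q + b) := by
      by_cases h : b = 0
      · subst h; simpa using Relation.ReflTransGen.refl
      · refine .single ⟨by simpa using hN a 0 ha (by simp), hN a b ha hb, ?_⟩
        rw [abs_le] at hb
        have : b = 1 ∨ b = -1 := by omega
        rcases this with rfl | rfl <;> simp [EdgeAdj, sub_eq_add_neg]
    exact s1.trans s2
  have hblock' : ∀ t ∈ C, ∀ s : ℤ × ℤ, |s.1 - t.1| ≤ 1 → |s.2 - t.2| ≤ 1 →
      Relation.ReflTransGen r t s := by
    intro t ht s h1 h2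
    simpa using hblock t ht _ _ h1 h2
  -- This is where connectedness of the complement enters: close points lie in squares joined within
  -- `N`, so all of `N` is joined, including the squares outside the box.
  have hcore : ∀ x ∈ Wᶜ, ∀ y ∈ Wᶜ, Relation.ReflTransGen r (φ x) (φ y) := by
    intro x hx y hy
    refine hWc.induction₂ (fun x y => Relation.ReflTransGen r (φ x) (φ y)) ?_
      (fun x y z _ _ _ h1 h2 => h1.trans h2)
      (fun x y _ _ h => hRsymm _ _ h) hx hy
    intro x hx
    filter_upwards [mem_nhdsWithin_of_mem_nhds (Metric.ball_mem_nhds x hε)] with y hy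
    obtain ⟨h1, h2⟩ := hφd y x hy
    exact hblock' _ ⟨x, hx, rfl⟩ _ h1 h2
  have hreach : ∀ s ∈ N, ∃ t ∈ T, Relation.ReflTransGen r s t := by
    rintro s ⟨t, ⟨x, hx, rfl⟩, h1, h2⟩
    have hT : ((-1, 0) : ℤ × ℤ) ∈ T := by simp [T]
    obtain ⟨y, hy, hyT⟩ := hTC hT
    refine ⟨_, hT, Relation.ReflTransGen.trans ?_ (hyT ▸ hcore x hx y hy)⟩
    exact hRsymm _ _ (hblock' _ ⟨x, hx, rfl⟩ _ h1 h2)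
  obtain ⟨d, π, hdπ⟩ := exists_rank r T
  -- Only the squares of `N` inside the box are repaired. Each is linked through `N` to a square
  -- outside the box, where no flatness is required, and labels around squares off `N` stay
  -- unchanged.
  let B : Finset (ℤ × ℤ) := (Finset.Ico 0 (M : ℤ) ×ˢ Finset.Ico 0 (M : ℤ)).filter (· ∈ N)
  obtain ⟨h', v', hag, hfl⟩ := exists_flat_extension d π B Nᶜ (by
    intro s hs
    simp only [B, Finset.mem_filter, Finset.mem_product, Finset.mem_Ico] at hs
    obtain ⟨⟨h1, h2, h3⟩, h4⟩ := hdπ s (fun h => h hs.1) (hreach s hs.2)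
    exact ⟨fun h => h h1, fun h => h h2, h3, h4⟩) _ _ hflat
  obtain ⟨b, hbv, hbh⟩ := exists_vertex_potential h' v' M (by
    intro i j hi hj
    refine hfl _ ?_
    by_cases hN : ((i : ℤ), (j : ℤ)) ∈ N
    · right; simp [B, hN, hi, hj]
    · exact Or.inl hN)
  have hsq : ∀ s ∉ N, b (s.1 + 1) s.2 = b s.1 s.2 * c (V s.1 s.2) (V (s.1 + 1) s.2) ∧
      b s.1 (s.2 + 1) = b s.1 s.2 * c (V s.1 s.2) (V s.1 (s.2 + 1)) := by
    rintro ⟨i, j⟩ hs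
    have hT : (i, j) ∉ T := fun h => hs (hCN (hTC h))
    simp only [T, Set.mem_ofPred_eq, not_not] at hT
    obtain ⟨⟨hi0, hi⟩, hj0, hj⟩ := hT
    obtain ⟨a1, -, a2, -⟩ := hag _ hs
    lift i to ℕ using hi0
    lift j to ℕ using hj0
    simp only at a1 a2 ⊢
    rw [hbv, hbh i j (by omega) (by omega), a1, a2]
    exact ⟨rfl, rfl⟩
  -- The vertex potential is transported from the corner of a square to its points. For `x` and `y`
  -- closer than `ε` the two corners differ by at most one step in each direction, so at most two
  -- grid edges of unmodified squares, inside one ball in `W`, join them.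
  refine ⟨fun x => b (φ x).1 (φ x).2 * c (V (φ x).1 (φ x).2) x, ε, hε, fun x hx y hy hxy => ?_⟩
  have hxW : Metric.ball x (20 * ε) ⊆ W := fun z hz =>
    hηW (Metric.mem_thickening_iff.2 ⟨x, hx, hz⟩)
  have hcx := hc x _ hxW
  obtain ⟨hp, hq⟩ := hφd y x (by rwa [dist_comm])
  have x0 := hφ0 x
  have x1 := hφ1 x
  beta_reduce
  generalize φ x = P at *
  generalize φ y = Q at *
  obtain ⟨p, q⟩ := P
  obtain ⟨p', q'⟩ := Q
  simp only at hp hq x0 x1 ⊢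
  rw [abs_le] at hp hq
  have coordbd : ∀ (t s : ℝ) (k l : ℤ), ε * k ≤ t + R → t + R < ε * (k + 1) →
      ε * l ≤ s + R → s + R ≤ ε * (l + 1) → |l - k| ≤ 3 → |s - t| ≤ 4 * ε := by
    intro t s k l h1 h2 h3 h4 h5
    rw [abs_le] at h5 ⊢
    have u1 : (l : ℝ) ≤ k + 3 := by have : l ≤ k + 3 := by omega
                                    exact_mod_cast this
    have u2 : (k : ℝ) ≤ l + 3 := by have : k ≤ l + 3 := by omega
                                    exact_mod_cast this
    have w1 := mul_le_mul_of_nonneg_left u1 hε.le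
    have w2 := mul_le_mul_of_nonneg_left u2 hε.le
    constructor <;> linarith
  have distbd : ∀ z : Plane, |z 0 - x 0| ≤ 4 * ε → |z 1 - x 1| ≤ 4 * ε →
      z ∈ Metric.ball x (20 * ε) := by
    intro z h0 h1
    refine dist_lt_of_sq_lt (by positivity) ?_
    have := sq_le_sq' (abs_le.1 h0).1 (abs_le.1 h0).2
    have := sq_le_sq' (abs_le.1 h1).1 (abs_le.1 h1).2
    nlinarith [pow_pos hε 2]
  have hVmem : ∀ i j : ℤ, |i - p| ≤ 3 → |j - q| ≤ 3 → V i j ∈ Metric.ball x (20 * ε) := by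
    intro i j hi hj
    refine distbd _ (coordbd _ _ p i x0.1 x0.2 ?_ ?_ hi) (coordbd _ _ q j x1.1 x1.2 ?_ ?_ hj) <;>
      simp only [hV0, hV1] <;> linarith
  have hnN : ∀ i j : ℤ, |i - p| ≤ 2 → |j - q| ≤ 2 → (i, j) ∉ N := by
    rintro i j hi hj ⟨t, ⟨z, hz, rfl⟩, h1, h2⟩
    refine hz (hxW (distbd z ?_ ?_))
    · have := hφ0 z
      refine coordbd _ _ p (φ z).1 x0.1 x0.2 this.1 this.2.le ?_
      rw [abs_le] at *; simp only at *; omega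
    · have := hφ1 z
      refine coordbd _ _ q (φ z).2 x1.1 x1.2 this.1 this.2.le ?_
      rw [abs_le] at *; simp only at *; omega
  have hone : ∀ z ∈ Metric.ball x (20 * ε), c z z = 1 := fun z hz => by
    simpa using hcx z hz z hz z hz
  have hinv : ∀ z ∈ Metric.ball x (20 * ε), ∀ w ∈ Metric.ball x (20 * ε),
      c z w = (c w z)⁻¹ := fun z hz w hw => by
    rw [eq_inv_iff_mul_eq_one, hcx z hz w hw z hz, hone z hz]
  have habs : ∀ k : ℤ, -3 ≤ k → k ≤ 3 → |k| ≤ 3 := fun k h1 h2 => abs_le.2 ⟨h1, h2⟩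
  have habs2 : ∀ k : ℤ, -2 ≤ k → k ≤ 2 → |k| ≤ 2 := fun k h1 h2 => abs_le.2 ⟨h1, h2⟩
  have m1 : V p q ∈ Metric.ball x (20 * ε) := hVmem _ _ (by simp) (by simp)
  have m2 : V p' q ∈ Metric.ball x (20 * ε) :=
    hVmem _ _ (habs _ (by omega) (by omega)) (by simp)
  have m3 : V p' q' ∈ Metric.ball x (20 * ε) :=
    hVmem _ _ (habs _ (by omega) (by omega)) (habs _ (by omega) (by omega))
  have mx : x ∈ Metric.ball x (20 * ε) := Metric.mem_ball_self (by positivity)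
  have my : y ∈ Metric.ball x (20 * ε) := by
    rw [Metric.mem_ball, dist_comm]; linarith
  have step1 : b p' q = b p q * c (V p q) (V p' q) := by
    obtain rfl | rfl | rfl : p' = p ∨ p' = p + 1 ∨ p' = p - 1 := by omega
    · rw [hone _ m1, mul_one]
    · exact (hsq _ (hnN p q (by simp) (by simp))).1
    · have := (hsq _ (hnN (p - 1) q (habs2 _ (by omega) (by omega)) (by simp))).1
      simp only [sub_add_cancel] at this
      rw [this, hinv _ m1 _ m2, mul_inv_cancel_right]
  have step2 : b p' q' = b p' q * c (V p' q) (V p' q') := by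
    have ap : |p' - p| ≤ 2 := habs2 _ (by omega) (by omega)
    obtain rfl | rfl | rfl : q' = q ∨ q' = q + 1 ∨ q' = q - 1 := by omega
    · rw [hone _ m2, mul_one]
    · exact (hsq _ (hnN p' q ap (by simp))).2
    · have := (hsq _ (hnN p' (q - 1) ap (habs2 _ (by omega) (by omega)))).2
      simp only [sub_add_cancel] at this
      rw [this, hinv _ m2 _ m3, mul_inv_cancel_right]
  rw [step2, step1, mul_assoc (b p q), hcx _ m1 _ m2 _ m3, mul_assoc (b p q), hcx _ m1 _ m3 _ my,
    mul_inv_rev, mul_assoc, inv_mul_cancel_left, ← hinv _ mx _ m1, hcx _ mx _ m1 _ my]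

/-! ### Simple connectedness from a connected complement -/

/-- A path connected space carries a group valued holonomy of paths that detects whether loops are
null-homotopic. -/
lemma exists_path_holonomy (Y : Type*) [TopologicalSpace Y] [PathConnectedSpace Y] (x₀ : Y) :
    ∃ κ : ∀ x y : Y, Path x y → FundamentalGroup Y x₀,
      (∀ x y z (p : Path x y) (q : Path y z), κ x z (p.trans q) = κ x y p * κ y z q) ∧
      (∀ x y (p q : Path x y), p.Homotopic q → κ x y p = κ x y q) ∧
      ∀ x (p : Path x x), κ x x p = 1 → p.Homotopic (Path.refl x) := by
  -- A chosen path from the base point to every point closes each path up to a loop at `x₀`.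
  let τ : ∀ x : Y, FundamentalGroupoid.mk x₀ ⟶ FundamentalGroupoid.mk x := fun x =>
    Path.Homotopic.Quotient.mk (PathConnectedSpace.somePath x₀ x)
  let cl : ∀ {x y : Y}, Path x y → (FundamentalGroupoid.mk x ⟶ FundamentalGroupoid.mk y) :=
    fun p => Path.Homotopic.Quotient.mk p
  have hcl : ∀ {x y z : Y} (p : Path x y) (q : Path y z),
      cl (p.trans q) = CategoryTheory.CategoryStruct.comp (cl p) (cl q) := fun p q =>
    Path.Homotopic.Quotient.mk_trans p q
  have hτ : ∀ {y z : Y} (g : FundamentalGroupoid.mk y ⟶ FundamentalGroupoid.mk z),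
      CategoryTheory.CategoryStruct.comp (CategoryTheory.Groupoid.inv (τ y))
        (CategoryTheory.CategoryStruct.comp (τ y) g) = g := fun g => by
    rw [← CategoryTheory.Category.assoc, CategoryTheory.Groupoid.inv_comp,
      CategoryTheory.Category.id_comp]
  let ρ : ∀ x y : Y, Path x y → FundamentalGroup Y x₀ := fun x y p =>
    CategoryTheory.CategoryStruct.comp (τ x)
      (CategoryTheory.CategoryStruct.comp (cl p) (CategoryTheory.Groupoid.inv (τ y)))
  have hρ : ∀ x y z (p : Path x y) (q : Path y z), ρ x z (p.trans q) = ρ y z q * ρ x y p := by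
    intro x y z p q
    rw [CategoryTheory.End.mul_def]
    simp only [ρ, hcl, CategoryTheory.Category.assoc, hτ]
  -- Multiplication of endomorphisms reverses composition, so `ρ` reverses products; the inverse
  -- restores the order.
  refine ⟨fun x y p => (ρ x y p)⁻¹, fun x y z p q => by beta_reduce; rw [hρ, mul_inv_rev], fun x y p q h => ?_, fun x p h => ?_⟩
  · have : cl p = cl q := Path.Homotopic.Quotient.eq.2 h
    simp only [ρ, this]
  · have h1 : ρ x x p = 1 := inv_eq_one.1 h
    have h2 : cl p = CategoryTheory.CategoryStruct.id _ := by
      have h3 : CategoryTheory.CategoryStruct.comp (CategoryTheory.Groupoid.inv (τ x))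
          (CategoryTheory.CategoryStruct.comp (ρ x x p : FundamentalGroupoid.mk x₀ ⟶ _) (τ x))
          = cl p := by
        simp only [ρ, CategoryTheory.Category.assoc, CategoryTheory.Groupoid.inv_comp,
          hτ, CategoryTheory.Category.comp_id]
      rw [← h3, h1, CategoryTheory.End.one_def]
      simp
    exact Path.Homotopic.Quotient.exact h2

/-- Two paths in a convex subset are homotopic. -/
lemma homotopic_of_convex {W C : Set Plane} (hC : Convex ℝ C) (hCW : C ⊆ W) {x y : W}
    (p q : Path x y) (hp : ∀ t, (p t : Plane) ∈ C) (hq : ∀ t, (q t : Plane) ∈ C) :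
    p.Homotopic q := by
  have hx : (x : Plane) ∈ C := by simpa using hp 0
  have hy : (y : Plane) ∈ C := by simpa using hp 1
  have : ContractibleSpace C := hC.contractibleSpace ⟨x, hx⟩
  let p' : Path (⟨x, hx⟩ : C) ⟨y, hy⟩ :=
    ⟨⟨fun t => ⟨p t, hp t⟩, by fun_prop⟩, by simp, by simp⟩
  let q' : Path (⟨x, hx⟩ : C) ⟨y, hy⟩ :=
    ⟨⟨fun t => ⟨q t, hq t⟩, by fun_prop⟩, by simp, by simp⟩
  have h := SimplyConnectedSpace.paths_homotopic p' q'
  exact h.map ⟨Set.inclusion hCW, continuous_inclusion hCW⟩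

/-- A bounded plane domain whose complement is connected is simply connected. -/
theorem isSimplyConnected_of_isPreconnected_compl {W : Set Plane} (hWo : IsOpen W)
    (hWb : Bornology.IsBounded W) (hW : IsConnected W) (hWc : IsPreconnected Wᶜ) :
    IsSimplyConnected W := by
  classical
  have hpc : PathConnectedSpace W := isPathConnected_iff_pathConnectedSpace.1
    (hWo.isConnected_iff_isPathConnected.1 hW)
  rw [IsSimplyConnected, simply_connected_iff_loops_nullhomotopic]
  refine ⟨hpc, fun x₀ γ => ?_⟩
  obtain ⟨κ, hκ, hκh, hκ1⟩ := exists_path_holonomy W x₀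
  refine hκ1 _ _ ?_
  have hseg : ∀ (x y : W) (C : Set Plane), Convex ℝ C → C ⊆ W → (x : Plane) ∈ C →
      (y : Plane) ∈ C → ∃ p : Path x y, ∀ t, (p t : Plane) ∈ C := by
    intro x y C hC hCW hx hy
    have hm : ∀ t, Path.segment (x : Plane) y t ∈ C := by
      intro t
      have : Path.segment (x : Plane) y t ∈ segment ℝ (x : Plane) y := by
        rw [← Path.range_segment]; exact Set.mem_range_self t
      exact hC.segment_subset hx hy this
    exact ⟨⟨⟨fun t => ⟨_, hCW (hm t)⟩, by fun_prop⟩, by simp, by simp⟩, hm⟩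
  -- The cocycle is the holonomy from `x` to `y` inside any convex subset of `W`: such a subset
  -- contains the segment, so all these paths are homotopic. The value 1 is used when the segment
  -- leaves `W`.
  have hex : ∀ x y : Plane, ∃ g : FundamentalGroup W x₀, ∀ (hx : x ∈ W) (hy : y ∈ W)
      (C : Set Plane), Convex ℝ C → C ⊆ W → ∀ p : Path (⟨x, hx⟩ : W) ⟨y, hy⟩,
      (∀ t, (p t : Plane) ∈ C) → g = κ _ _ p := by
    intro x y
    by_cases h : ∃ (hx : x ∈ W) (hy : y ∈ W), segment ℝ x y ⊆ W
    · obtain ⟨hx, hy, hs⟩ := h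
      obtain ⟨q, hq⟩ := hseg ⟨x, hx⟩ ⟨y, hy⟩ _ (convex_segment x y) hs
        (left_mem_segment ℝ x y) (right_mem_segment ℝ x y)
      refine ⟨κ _ _ q, fun hx hy C hC hCW p hp => hκh _ _ _ _ ?_⟩
      refine homotopic_of_convex hC hCW q p (fun t => hC.segment_subset ?_ ?_ (hq t)) hp
      · simpa using hp 0
      · simpa using hp 1
    · refine ⟨1, fun hx hy C hC hCW p hp => (h ⟨hx, hy, ?_⟩).elim⟩
      exact (hC.segment_subset (by simpa using hp 0) (by simpa using hp 1)).trans hCW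
  choose c hc using hex
  have hX : IsCompact (Set.range fun t => (γ t : Plane)) :=
    isCompact_range (by fun_prop)
  obtain ⟨b, δ, hδ, hb⟩ := exists_local_potential hWb hWo hWc hX
    (by rintro _ ⟨t, rfl⟩; exact (γ t).2) c (by
      intro o r hor x hx y hy z hz
      have hC := convex_ball o r
      obtain ⟨p, hp⟩ := hseg ⟨x, hor hx⟩ ⟨y, hor hy⟩ _ hC hor hx hy
      obtain ⟨q, hq⟩ := hseg ⟨y, hor hy⟩ ⟨z, hor hz⟩ _ hC hor hy hz
      rw [hc x y _ _ _ hC hor p hp, hc y z _ _ _ hC hor q hq, hc x z _ _ _ hC hor (p.trans q),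
        hκ]
      intro t
      have : (p.trans q) t ∈ Set.range p ∪ Set.range q := by
        rw [← Path.trans_range]; exact Set.mem_range_self t
      rcases this with ⟨s, hs⟩ | ⟨s, hs⟩
      · rw [← hs]; exact hp s
      · rw [← hs]; exact hq s)
  have hrefl : ∀ x : W, κ x x (Path.refl x) = 1 := by
    intro x
    have := hκ x x x (Path.refl x) (Path.refl x)
    rw [Path.refl_trans_refl] at this
    exact left_eq_mul.1 this
  -- The holonomy along `γ` up to time `t` and the potential `b (γ t)` change by the same factor, so
  -- `f` is locally constant. Comparing the ends, where the potentials agree, shows that `γ` has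
  -- trivial holonomy.
  let f : unitInterval → FundamentalGroup W x₀ := fun t =>
    κ _ _ (γ.subpath 0 t) * (b (γ t))⁻¹
  have hf : IsLocallyConstant f := by
    rw [IsLocallyConstant.iff_eventually_eq]
    intro t
    obtain ⟨r, hr, hrW⟩ := Metric.isOpen_iff.1 hWo (γ t) (γ t).2
    have hball : Metric.ball (γ t : Plane) (min r δ) ⊆ W :=
      (Metric.ball_subset_ball (min_le_left _ _)).trans hrW
    have hcont : Continuous fun s => (γ s : Plane) := by fun_prop
    obtain ⟨ρ, hρ, hρt⟩ := Metric.continuousAt_iff.1 (hcont.continuousAt (x := t)) (min r δ)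
      (lt_min hr hδ)
    filter_upwards [Metric.ball_mem_nhds t hρ] with s hs
    have hsub : ∀ u, (γ.subpath t s u : Plane) ∈ Metric.ball (γ t : Plane) (min r δ) := by
      intro u
      have : γ.subpath t s u ∈ γ '' Set.uIcc t s := by
        rw [← Path.range_subpath]; exact Set.mem_range_self u
      obtain ⟨w, hw, hwu⟩ := this
      rw [← hwu]
      refine hρt (lt_of_le_of_lt ?_ hs)
      rw [Subtype.dist_eq, Subtype.dist_eq, dist_comm (s : ℝ)]
      rw [dist_comm]
      refine Real.dist_left_le_of_mem_uIcc ?_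
      rcases le_total t s with h | h
      · rw [Set.uIcc_of_le h] at hw
        rw [Set.uIcc_of_le (by exact_mod_cast h)]
        exact hw
      · rw [Set.uIcc_of_ge h] at hw
        rw [Set.uIcc_of_ge (by exact_mod_cast h)]
        exact hw
    have h1 : κ _ _ (γ.subpath 0 s) = κ _ _ (γ.subpath 0 t) * κ _ _ (γ.subpath t s) := by
      rw [← hκ]
      exact (hκh _ _ _ _ ⟨Path.Homotopy.subpathTransSubpath γ 0 t s⟩).symm
    have h2 := hc (γ t) (γ s) (γ t).2 (γ s).2 _ (convex_ball _ _) hball (γ.subpath t s) hsub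
    have h3 := hb (γ t) ⟨t, rfl⟩ (γ s) ⟨s, rfl⟩ (by
      have := hρt hs
      rw [dist_comm]
      exact this.trans_le (min_le_right _ _))
    simp only [f]
    rw [h1]
    erw [← h2]
    rw [h3]
    group
  have h01 := hf.apply_eq_of_preconnectedSpace 1 0
  have hcast : ∀ (x y x' y' : W) (p : Path x y) (hx : x' = x) (hy : y' = y),
      κ x' y' (p.cast hx hy) = κ x y p := by
    rintro x y _ _ p rfl rfl
    rfl
  simp only [f, Path.subpath_zero_one, Path.subpath_self, hrefl, hcast, γ.source, γ.target] at h01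
  exact mul_right_cancel h01

/-! ### Exactness of closed forms -/

/-- On a simply connected space, local functions whose differences are locally constant are the
restrictions, up to locally constant functions, of a global one. -/
lemma exists_glued_function {X F : Type*} [TopologicalSpace X] [SimplyConnectedSpace X]
    [LocallyPathConnectedSpace X] [AddCommGroup F]
    (U : X → Set X) (hU : ∀ i, IsOpen (U i)) (hmem : ∀ x, x ∈ U x) (f : X → X → F)
    (hf : ∀ i j, ∀ x ∈ U i ∩ U j, ∀ᶠ y in 𝓝 x, f i y - f j y = f i x - f j x) :
    ∃ g : X → F, ∀ i, ∀ x ∈ U i, ∀ᶠ y in 𝓝 x, g y - f i y = g x - f i x := by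
  -- With discrete fibre, the bundle with translations `f i - f j` as transition maps is a covering.
  -- Simple connectedness lifts the identity to a section, and adding the local functions back gives
  -- `g`.
  let _ : TopologicalSpace F := ⊥
  have : DiscreteTopology F := ⟨rfl⟩
  let Z : FiberBundleCore X X F :=
    { baseSet := U
      isOpen_baseSet := hU
      indexAt := id
      mem_baseSet_at := hmem
      coordChange := fun i j x t => t + (f i x - f j x)
      coordChange_self := fun i x _ v => by simp
      continuousOn_coordChange := fun i j => by
        refine continuousOn_snd.add ?_
        rintro ⟨x, t⟩ ⟨hx, -⟩
        refine ContinuousAt.continuousWithinAt ?_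
        have h1 : ContinuousAt (fun y => f i y - f j y) x :=
          (continuousAt_const (y := f i x - f j x)).congr
            ((hf i j x hx).mono fun y hy => hy.symm)
        exact h1.comp (f := Prod.fst) (x := (x, t)) continuousAt_fst
      coordChange_comp := fun i j k x _ v => by abel }
  have hcov : IsCoveringMap (Bundle.TotalSpace.proj : Z.TotalSpace → X) :=
    FiberBundle.isCoveringMap
  obtain ⟨x₀⟩ : Nonempty X := inferInstance
  obtain ⟨s, ⟨-, hs⟩, -⟩ := hcov.existsUnique_continuousMap_lifts (ContinuousMap.id X) x₀
    (⟨x₀, (0 : F)⟩ : Z.TotalSpace) rfl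
  have hs' : ∀ x, (s x).proj = x := fun x => congrFun hs x
  let g : X → F := fun x => (show F from (s x).2) + f (s x).proj x
  refine ⟨g, fun i x hx => ?_⟩
  have key : ∀ y, (Z.localTriv i (s y)).2 = g y - f i y := by
    intro y
    rw [Z.localTriv_apply]
    change (show F from (s y).2) + (f (s y).proj (s y).proj - f i (s y).proj) =
      (show F from (s y).2) + f (s y).proj y - f i y
    rw [hs' y]
    abel
  have hcont : ContinuousAt (fun y => (Z.localTriv i (s y)).2) x := by
    have h1 : ContinuousAt (Z.localTriv i) (s x) := by
      refine (Z.localTriv i).continuousAt ?_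
      rw [Bundle.Trivialization.mem_source]
      change (s x).proj ∈ U i
      rwa [hs' x]
    exact continuous_snd.continuousAt.comp
      (ContinuousAt.comp (f := s) (x := x) h1 s.continuous.continuousAt)
  have := hcont.eventually (show ∀ᶠ t in 𝓝 (Z.localTriv i (s x)).2, t = (Z.localTriv i (s x)).2 by
    rw [nhds_discrete]; simp)
  filter_upwards [this] with y hy
  rw [← key, ← key, hy]

/-- A closed one-form on a simply connected open set is exact. -/
theorem exists_primitive_of_isSimplyConnected {W : Set Plane} (hWo : IsOpen W)
    (hW : IsSimplyConnected W) {A : Plane → (Plane →L[ℝ] ℝ)}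
    (hA : DifferentiableOn ℝ A W) (hsymm : ∀ x ∈ W, ∀ v w, fderiv ℝ A x v w = fderiv ℝ A x w v) :
    ∃ ψ : Plane → ℝ, ∀ x ∈ W, HasFDerivAt ψ (A x) x := by
  classical
  have := hW.simplyConnectedSpace
  have := hWo.locallyPathConnectedSpace
  have hloc : ∀ x : W, ∃ r > 0, Metric.ball (x : Plane) r ⊆ W ∧ ∃ f : Plane → ℝ,
      ∀ y ∈ Metric.ball (x : Plane) r, HasFDerivAt f (A y) y := by
    intro x
    obtain ⟨r, hr, hrW⟩ := Metric.isOpen_iff.1 hWo x x.2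
    obtain ⟨f, hf⟩ : ∃ f : Plane → ℝ, ∀ y ∈ Metric.ball (x : Plane) r,
        HasFDerivWithinAt f (A y) (Metric.ball (x : Plane) r) y := (convex_ball (x : Plane) r)
      |>.exists_forall_hasFDerivWithinAt_of_hasFDerivWithinAt_symmetric
      (fun y hy => ((hA.differentiableAt (hWo.mem_nhds (hrW hy))).hasFDerivAt).hasFDerivWithinAt)
      (fun y hy v _ w _ => hsymm y (hrW hy) v w)
    exact ⟨r, hr, hrW, f, fun y hy => (hf y hy).hasFDerivAt (Metric.isOpen_ball.mem_nhds hy)⟩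
  choose r hr hrW f hf using hloc
  have hopen : ∀ i : W, IsOpen {x : W | (x : Plane) ∈ Metric.ball (i : Plane) (r i)} := fun i =>
    Metric.isOpen_ball.preimage continuous_subtype_val
  obtain ⟨g, hg⟩ := exists_glued_function (X := W) (F := ℝ)
    (fun i => {x : W | (x : Plane) ∈ Metric.ball (i : Plane) (r i)}) hopen
    (fun x => Metric.mem_ball_self (hr x)) (fun i x => f i x) (by
      rintro i j x ⟨hi, hj⟩
      have hconv : Convex ℝ (Metric.ball (i : Plane) (r i) ∩ Metric.ball (j : Plane) (r j)) :=
        (convex_ball _ _).inter (convex_ball _ _)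
      filter_upwards [(hopen i).mem_nhds hi, (hopen j).mem_nhds hj] with y yi yj
      refine hconv.is_const_of_fderivWithin_eq_zero (𝕜 := ℝ) (f := fun z => f i z - f j z)
        (fun z hz => ?_) (fun z hz => ?_) ⟨yi, yj⟩ ⟨hi, hj⟩
      · exact ((hf i z hz.1).sub (hf j z hz.2)).differentiableAt.differentiableWithinAt
      · rw [fderivWithin_of_isOpen (Metric.isOpen_ball.inter Metric.isOpen_ball) hz,
          ((hf i z hz.1).fun_sub (hf j z hz.2)).fderiv, sub_self])
  refine ⟨fun x => if hx : x ∈ W then g ⟨x, hx⟩ else 0, fun x hx => ?_⟩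
  have h1 := hg ⟨x, hx⟩ ⟨x, hx⟩ (Metric.mem_ball_self (hr _))
  have h2 : ∀ᶠ y in 𝓝 x, (if hx : y ∈ W then g ⟨y, hx⟩ else 0) =
      f ⟨x, hx⟩ y + (g ⟨x, hx⟩ - f ⟨x, hx⟩ x) := by
    rw [← map_nhds_subtype_coe_eq_nhds (p := (· ∈ W)) hx (hWo.mem_nhds hx), eventually_map]
    filter_upwards [h1] with y hy
    rw [dif_pos y.2, ← hy]
    ring
  refine HasFDerivAt.congr_of_eventuallyEq ?_ h2
  exact (hf ⟨x, hx⟩ x (Metric.mem_ball_self (hr _))).add_const _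

/-! ### Winding obstructions -/

/-- The identification of the plane with `ℂ`. -/
noncomputable def toC : Plane ≃ₗᵢ[ℝ] ℂ := Complex.orthonormalBasisOneI.repr.symm

lemma isSimplyConnected_univ_plane : IsSimplyConnected (Set.univ : Set Plane) := by
  have : ContractibleSpace (Set.univ : Set Plane) :=
    convex_univ.contractibleSpace Set.univ_nonempty
  exact SimplyConnectedSpace.ofContractible _

/-- The function `z - p` cannot be changed on a bounded set to a continuous function without
zeros. -/
lemma false_of_continuous_ne_zero {H : Plane → ℂ} (hH : Continuous H) (h0 : ∀ z, H z ≠ 0)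
    (p : Plane) (R : ℝ) (hR : ∀ z, R ≤ dist z p → H z = toC (z - p)) : False := by
  obtain ⟨f, hf, hfe⟩ := Complex.exists_continuousOn_eqOn_exp_comp isSimplyConnected_univ_plane
    isOpen_univ hH.continuousOn (by rintro ⟨z, -, hz⟩; exact h0 z hz)
  rw [continuousOn_univ] at hf
  set ρ : ℝ := max R 1 with hρ
  have hρ0 : 0 < ρ := by positivity
  let c : ℝ → Plane := fun θ => p + toC.symm (ρ * Complex.exp (θ * Complex.I))
  have hc : Continuous c := by fun_prop
  have hcH : ∀ θ, H (c θ) = ρ * Complex.exp (θ * Complex.I) := by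
    intro θ
    rw [hR]
    · simp [c]
    · simp only [c, dist_eq_norm, add_sub_cancel_left, LinearIsometryEquiv.norm_map, norm_mul,
        Complex.norm_exp_ofReal_mul_I, Complex.norm_real, mul_one, Real.norm_eq_abs,
        abs_of_pos hρ0]
      exact le_max_left _ _
  -- On a large circle the logarithm of `H` must be the lift of `ρ * exp (iθ)`, which gains `2πi` in
  -- a turn, although the circle closes up.
  have hlift : (fun θ : ℝ => f (c θ)) = fun θ : ℝ => f (c 0) + θ * Complex.I := by
    have hinj : IsLocallyInjective Complex.exp :=
      (isLocalHomeomorph_iff_isLocalHomeomorphOn_univ.2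
        (Complex.isCoveringMapOn_exp.isLocalHomeomorphOn.mono
          fun z _ => Complex.exp_ne_zero z)).isLocallyInjective
    refine T2Space.isSeparatedMap Complex.exp |>.eq_of_comp_eq hinj (hf.comp hc) (by fun_prop)
      ?_ 0 (by simp)
    funext θ
    have h1 : ∀ z, Complex.exp (f z) = H z := fun z => hfe (Set.mem_univ z)
    simp only [Function.comp_apply, Complex.exp_add, h1, hcH]
    simp
  have h2 : c (2 * Real.pi) = c 0 := by simp [c]
  have h3 := congrFun hlift (2 * Real.pi)
  simp only [h2] at h3
  have h4 : ((2 * Real.pi : ℝ) : ℂ) * Complex.I = 0 := by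
    linear_combination -h3
  simp [Real.pi_ne_zero] at h4

/-- If `K` is a compact set and `W ∪ K` is a neighbourhood of it, then `z - p`, with `p` in `K`, is not the
product of a continuous exponential on `W` and a function without zeros on `W ∪ K`. -/
lemma false_of_exp_factor {K W : Set Plane} (hK : IsCompact K) (hWK : Disjoint W K)
    (hO : IsOpen (W ∪ K)) {p : Plane} (hp : p ∈ K) {m F : Plane → ℂ} (hm : Continuous m)
    (hm0 : ∀ z ∈ W ∪ K, m z ≠ 0) (hF : ContinuousOn F W)
    (h : ∀ z ∈ W, toC (z - p) = m z * Complex.exp (F z)) : False := by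
  classical
  obtain ⟨K₂, hK₂, hKK₂, hK₂O⟩ := exists_compact_between hK hO Set.subset_union_right
  obtain ⟨K₁, hK₁, hKK₁, hK₁₂⟩ := exists_compact_between hK isOpen_interior hKK₂
  obtain ⟨φ, hφ0, hφ1, -⟩ := exists_continuous_zero_one_of_isCompact hK₁
    (isOpen_interior (s := K₂)).isClosed_compl
    (Set.disjoint_compl_right_iff_subset.2 hK₁₂)
  have hW : IsOpen W := by
    have : W = (W ∪ K) ∩ Kᶜ := by
      rw [Set.union_inter_distrib_right, Set.inter_compl_self, Set.union_empty,
        Set.inter_eq_left.2 hWK.subset_compl_right]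
    rw [this]
    exact hO.inter hK.isClosed.isOpen_compl
  -- The exponent is switched off towards `K` and kept in full away from `K₂`. This turns `z - p`
  -- into a continuous function without zeros, altered only inside `K₂`.
  let H : Plane → ℂ := fun z => if z ∈ K then m z else
    if z ∈ W then m z * Complex.exp ((φ z : ℂ) * F z) else toC (z - p)
  have e1 : ∀ z ∈ K₁, H z = m z := by
    intro z hz
    by_cases hzK : z ∈ K
    · simp [H, hzK]
    · have hzW : z ∈ W := (hK₂O (interior_subset (hK₁₂ hz))).resolve_right hzK
      have : φ z = 0 := hφ0 hz
      simp [H, hzK, hzW, this]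
  have e2 : ∀ z ∈ W, H z = m z * Complex.exp ((φ z : ℂ) * F z) := by
    intro z hz
    simp [H, hz, hWK.notMem_of_mem_left hz]
  have e3 : ∀ z ∉ K₂, H z = toC (z - p) := by
    intro z hz
    have hzK : z ∉ K := fun hk => hz (interior_subset (hKK₂ hk))
    by_cases hzW : z ∈ W
    · have : φ z = 1 := hφ1 fun hi => hz (interior_subset hi)
      rw [e2 z hzW, this, h z hzW]
      simp
    · simp [H, hzK, hzW]
  have hcont : Continuous H := by
    rw [continuous_iff_continuousAt]
    intro z
    by_cases hzW : z ∈ W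
    · have hFz : ContinuousAt F z := hF.continuousAt (hW.mem_nhds hzW)
      have : ContinuousAt (fun z => m z * Complex.exp ((φ z : ℂ) * F z)) z := by
        refine hm.continuousAt.mul (Complex.continuous_exp.continuousAt.comp ?_)
        exact (Complex.continuous_ofReal.comp φ.continuous).continuousAt.mul hFz
      refine this.congr ?_
      filter_upwards [hW.mem_nhds hzW] with w hw using (e2 w hw).symm
    · by_cases hzK : z ∈ K
      · refine hm.continuousAt.congr ?_
        filter_upwards [isOpen_interior.mem_nhds (hKK₁ hzK)] with w hw
        exact (e1 w (interior_subset hw)).symm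
      · have hz2 : z ∈ K₂ᶜ := fun h2 => (hK₂O h2).elim hzW hzK
        have : ContinuousAt (fun z => toC (z - p)) z := by fun_prop
        refine this.congr ?_
        filter_upwards [hK₂.isClosed.isOpen_compl.mem_nhds hz2] with w hw using (e3 w hw).symm
  obtain ⟨R, hR⟩ := hK₂.isBounded.subset_ball p
  refine false_of_continuous_ne_zero hcont (fun z => ?_) p R (fun z hz => e3 z fun hz2 => ?_)
  · by_cases hzK : z ∈ K
    · rw [e1 z (interior_subset (hKK₁ hzK))]
      exact hm0 z (Or.inr hzK)
    · by_cases hzW : z ∈ W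
      · rw [e2 z hzW]
        exact mul_ne_zero (hm0 z (Or.inl hzW)) (Complex.exp_ne_zero _)
      · simp only [H, hzK, hzW, if_false]
        rw [Ne, LinearIsometryEquiv.map_eq_zero_iff, sub_eq_zero]
        rintro rfl
        exact hzK hp
  · exact absurd (hR hz2) (by simpa using hz)

/-- A simply connected open set does not surround a compact set. -/
lemma false_of_isSimplyConnected_of_surround {K W : Set Plane} (hK : IsCompact K)
    (hKn : K.Nonempty) (hWK : Disjoint W K) (hO : IsOpen (W ∪ K)) (hWo : IsOpen W)
    (hW : IsSimplyConnected W) : False := by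
  obtain ⟨p, hp⟩ := hKn
  have hc : Continuous fun z : Plane => toC (z - p) := by fun_prop
  obtain ⟨f, hf, hfe⟩ := Complex.exists_continuousOn_eqOn_exp_comp hW hWo hc.continuousOn (by
    rintro ⟨z, hz, hz0⟩
    simp only [LinearIsometryEquiv.map_eq_zero_iff, sub_eq_zero] at hz0
    subst hz0
    exact hWK.notMem_of_mem_left hz hp)
  refine false_of_exp_factor hK hWK hO hp (m := fun _ => 1) (F := f) continuous_const
    (fun _ _ => one_ne_zero) hf (fun z hz => ?_)
  rw [one_mul]
  exact (hfe hz).symm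

/-! ### The two components of the complement -/

lemma isPreconnected_norm_gt {R : ℝ} (hR : 0 ≤ R) : IsPreconnected {z : Plane | R < ‖z‖} := by
  have h1 : {z : Plane | R < ‖z‖} =
      (fun q : ℝ × Plane => q.1 • q.2) '' (Set.Ioi R ×ˢ Metric.sphere (0 : Plane) 1) := by
    ext z
    constructor
    · intro hz
      have hz0 : 0 < ‖z‖ := hR.trans_lt hz
      refine ⟨(‖z‖, ‖z‖⁻¹ • z), ⟨hz, ?_⟩, ?_⟩
      · simp [norm_smul, hz0.ne']
      · simp [smul_smul, hz0.ne']
    · rintro ⟨⟨t, w⟩, ⟨ht, hw⟩, rfl⟩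
      have ht' : R < t := ht
      have : ‖w‖ = 1 := by simpa using hw
      simpa [norm_smul, this, abs_of_pos (hR.trans_lt ht')] using ht'
  rw [h1]
  refine (isPreconnected_Ioi.prod (isPreconnected_sphere ?_ _ _)).image _
    (by fun_prop)
  rw [← Module.finrank_eq_rank, finrank_euclideanSpace_fin]
  norm_num

/-- The complement of a doubly connected domain consists of the hole and an unbounded component. -/
lemma IsDoublyConnectedDomain.exists_components {Ω : Set Plane} (hΩ : IsDoublyConnectedDomain Ω) :
    ∃ K U : Set Plane, holes Ω = {K} ∧ IsCompact K ∧ IsConnected K ∧ IsClosed U ∧ IsConnected U ∧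
      Disjoint K U ∧ Ωᶜ = K ∪ U := by
  obtain ⟨K, hK⟩ := Set.ncard_eq_one.1 hΩ.one_hole
  have hKh : K ∈ holes Ω := by rw [hK]; rfl
  obtain ⟨hKb, x, hx, hKx⟩ := hKh
  have hcl : IsClosed Ωᶜ := hΩ.isOpen.isClosed_compl
  have hcomp : ∀ y ∈ Ωᶜ, IsClosed (connectedComponentIn Ωᶜ y) := fun y hy => by
    rw [connectedComponentIn_eq_image hy]
    exact hcl.isClosedEmbedding_subtypeVal.isClosedMap _ isClosed_connectedComponent
  obtain ⟨R, hR0, hR⟩ : ∃ R : ℝ, 0 ≤ R ∧ ∀ z ∈ Ω, ‖z‖ ≤ R := by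
    obtain ⟨R, hR⟩ := hΩ.isBounded.exists_norm_le
    exact ⟨max R 0, le_max_right _ _, fun z hz => (hR z hz).trans (le_max_left _ _)⟩
  have hfar : {z : Plane | R < ‖z‖} ⊆ Ωᶜ := fun z hz hzΩ => (hR z hzΩ).not_gt hz
  obtain ⟨y, hy⟩ : ∃ y : Plane, R < ‖y‖ := by
    obtain ⟨y, hy⟩ := NormedSpace.exists_lt_norm ℝ Plane R
    exact ⟨y, hy⟩
  have hfarU : {z : Plane | R < ‖z‖} ⊆ connectedComponentIn Ωᶜ y :=
    (isPreconnected_norm_gt hR0).subset_connectedComponentIn hy hfar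
  have hunb : ∀ C : Set Plane, Bornology.IsBounded C → ∃ z, R < ‖z‖ ∧ z ∉ C := by
    intro C hC
    obtain ⟨S, hS⟩ := hC.exists_norm_le
    obtain ⟨z, hz⟩ := NormedSpace.exists_lt_norm ℝ Plane (max R S)
    exact ⟨z, (le_max_left _ _).trans_lt hz, fun hzC =>
      (hS z hzC).not_gt ((le_max_right _ _).trans_lt hz)⟩
  -- A component other than the hole is unbounded, so it contains points far out, and these all lie
  -- in one component.
  have hU : ∀ z ∈ Ωᶜ, z ∉ K → z ∈ connectedComponentIn Ωᶜ y := by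
    intro z hz hzK
    have hb : ¬ Bornology.IsBounded (connectedComponentIn Ωᶜ z) := by
      intro hb
      have : connectedComponentIn Ωᶜ z ∈ holes Ω := ⟨hb, z, hz, rfl⟩
      rw [hK, Set.mem_singleton_iff] at this
      exact hzK (this ▸ mem_connectedComponentIn hz)
    obtain ⟨w, hw, hwR⟩ : ∃ w ∈ connectedComponentIn Ωᶜ z, R < ‖w‖ := by
      by_contra! hcon
      exact hb (isBounded_iff_forall_norm_le.2 ⟨R, hcon⟩)
    rw [connectedComponentIn_eq (hfarU hwR), ← connectedComponentIn_eq hw]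
    exact mem_connectedComponentIn hz
  refine ⟨K, connectedComponentIn Ωᶜ y, hK,
    Metric.isCompact_of_isClosed_isBounded (hKx ▸ hcomp x hx) hKb, ?_, hcomp y (hfar hy), ?_, ?_, ?_⟩
  · rw [hKx]; exact isConnected_connectedComponentIn_iff.2 hx
  · exact isConnected_connectedComponentIn_iff.2 (hfar hy)
  · rw [Set.disjoint_left]
    intro z hzK hzU
    obtain ⟨w, hw, hwK⟩ := hunb K hKb
    refine hwK ?_
    rw [hKx] at hzK ⊢
    rw [connectedComponentIn_eq hzK, ← connectedComponentIn_eq hzU]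
    exact hfarU hw
  · refine Set.Subset.antisymm (fun z hz => ?_) (Set.union_subset ?_ ?_)
    · by_cases hzK : z ∈ K
      exacts [Or.inl hzK, Or.inr (hU z hz hzK)]
    · rw [hKx]; exact connectedComponentIn_subset _ _
    · exact connectedComponentIn_subset _ _

lemma exists_nearest_points {K U : Set Plane} (hK : IsCompact K) (hKn : K.Nonempty)
    (hU : IsClosed U) (hUn : U.Nonempty) :
    ∃ p ∈ K, ∃ q ∈ U, ∀ x ∈ K, ∀ y ∈ U, dist p q ≤ dist x y := by
  obtain ⟨p, hp, hpm⟩ := hK.exists_isMinOn hKn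
    (Metric.continuous_infDist_pt (s := U)).continuousOn
  obtain ⟨q, hq, hpq⟩ := hU.exists_infDist_eq_dist hUn p
  exact ⟨p, hp, q, hq, fun x hx y hy =>
    (hpq ▸ hpm hx : dist p q ≤ Metric.infDist x U).trans (Metric.infDist_le_dist_of_mem hy)⟩

/-! ### Cutting along a segment -/

/-- The affine coordinate of the plane that is `0` at `p` and `1` at `q`. -/
noncomputable def segCoord (p q z : Plane) : ℂ := toC (z - p) / toC (q - p)

section Segment

variable {p q : Plane}

lemma toC_sub_ne_zero (hpq : p ≠ q) : toC (q - p) ≠ 0 := by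
  rw [Ne, LinearIsometryEquiv.map_eq_zero_iff, sub_eq_zero]
  exact hpq.symm

lemma continuous_segCoord : Continuous (segCoord p q) := by
  unfold segCoord
  exact Continuous.div_const (by fun_prop) _

lemma segCoord_lineMap (hpq : p ≠ q) (a b : ℝ) (z w : Plane) (hab : a + b = 1) :
    segCoord p q (a • z + b • w) = a * segCoord p q z + b * segCoord p q w := by
  have : a • z + b • w - p = a • (z - p) + b • (w - p) := by
    rw [smul_sub, smul_sub, sub_add_sub_comm, ← add_smul, hab, one_smul]
  simp only [segCoord, this, map_add, map_smul, Complex.real_smul]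
  have := toC_sub_ne_zero hpq
  field_simp

lemma segCoord_self (hpq : p ≠ q) : segCoord p q p = 0 ∧ segCoord p q q = 1 := by
  have := toC_sub_ne_zero hpq
  exact ⟨by simp [segCoord], div_self this⟩

lemma segCoord_injective (hpq : p ≠ q) : Function.Injective (segCoord p q) := by
  intro z w h
  have := toC_sub_ne_zero hpq
  simp only [segCoord] at h
  have h1 := (div_left_inj' this).1 h
  simpa using toC.injective h1

lemma eq_lineMap_of_segCoord (hpq : p ≠ q) {z : Plane} {t : ℝ} (h : segCoord p q z = t) :
    (1 - t) • p + t • q = z := by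
  refine segCoord_injective hpq ?_
  rw [segCoord_lineMap hpq _ _ _ _ (by ring), (segCoord_self hpq).1, (segCoord_self hpq).2, h]
  simp

lemma mem_segment_iff_segCoord (hpq : p ≠ q) {z : Plane} :
    z ∈ segment ℝ p q ↔ ∃ t : ℝ, 0 ≤ t ∧ t ≤ 1 ∧ segCoord p q z = t := by
  constructor
  · rintro ⟨a, b, ha, hb, hab, rfl⟩
    refine ⟨b, hb, by linarith, ?_⟩
    rw [segCoord_lineMap hpq _ _ _ _ hab, (segCoord_self hpq).1, (segCoord_self hpq).2]
    simp
  · rintro ⟨t, h0, h1, h⟩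
    exact ⟨1 - t, t, by linarith, h0, by ring, eq_lineMap_of_segCoord hpq h⟩

lemma mem_openSegment_iff_segCoord (hpq : p ≠ q) {z : Plane} :
    z ∈ openSegment ℝ p q ↔ ∃ t : ℝ, 0 < t ∧ t < 1 ∧ segCoord p q z = t := by
  constructor
  · rintro ⟨a, b, ha, hb, hab, rfl⟩
    refine ⟨b, hb, by linarith, ?_⟩
    rw [segCoord_lineMap hpq _ _ _ _ hab, (segCoord_self hpq).1, (segCoord_self hpq).2]
    simp
  · rintro ⟨t, h0, h1, h⟩
    exact ⟨1 - t, t, by linarith, h0, by ring, eq_lineMap_of_segCoord hpq h⟩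

/-- The open half plane on one side of the line through `p` and `q`. -/
def sideOf (p q : Plane) (σ : ℝ) : Set Plane := {z | 0 < σ * (segCoord p q z).im}

lemma convex_sideOf (hpq : p ≠ q) (σ : ℝ) : Convex ℝ (sideOf p q σ) := by
  intro z hz w hw a b ha hb hab
  have hz' : 0 < σ * (segCoord p q z).im := hz
  have hw' : 0 < σ * (segCoord p q w).im := hw
  change 0 < σ * (segCoord p q _).im
  rw [segCoord_lineMap hpq _ _ _ _ hab]
  simp only [Complex.add_im, Complex.im_ofReal_mul]
  rcases ha.eq_or_lt with rfl | ha
  · obtain rfl : b = 1 := by linarith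
    simpa using hw'
  · nlinarith [mul_pos ha hz', mul_nonneg hb hw'.le]

lemma disjoint_sideOf_segment (hpq : p ≠ q) (σ : ℝ) : Disjoint (sideOf p q σ) (segment ℝ p q) := by
  rw [Set.disjoint_left]
  intro z hz hs
  obtain ⟨t, -, -, ht⟩ := (mem_segment_iff_segCoord hpq).1 hs
  have hz' : 0 < σ * (segCoord p q z).im := hz
  simp [ht] at hz'

lemma exists_mem_ball_sideOf (hpq : p ≠ q) {σ : ℝ} (hσ : σ ≠ 0) {x : Plane}
    (hx : x ∈ openSegment ℝ p q) {ε : ℝ} (hε : 0 < ε) :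
    (Metric.ball x ε ∩ sideOf p q σ).Nonempty := by
  have hd := toC_sub_ne_zero hpq
  let c : ℝ → Plane := fun t => x + toC.symm (t * (σ * Complex.I) * toC (q - p))
  have hc : Continuous c := by fun_prop
  have hc0 : c 0 = x := by simp [c]
  have h1 : ∀ᶠ t in 𝓝[>] (0 : ℝ), c t ∈ Metric.ball x ε := by
    refine mem_nhdsWithin_of_mem_nhds (hc.continuousAt.preimage_mem_nhds ?_)
    rw [hc0]; exact Metric.ball_mem_nhds x hε
  obtain ⟨t, ht, ht0⟩ := (h1.and self_mem_nhdsWithin).exists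
  refine ⟨c t, ht, ?_⟩
  obtain ⟨s, -, -, hs⟩ := (mem_openSegment_iff_segCoord hpq).1 hx
  have h2 : segCoord p q (c t) = s + t * (σ * Complex.I) := by
    rw [← hs]
    simp only [segCoord, c, add_sub_right_comm, map_add, LinearIsometryEquiv.apply_symm_apply]
    field_simp
  change 0 < σ * (segCoord p q (c t)).im
  rw [h2]
  have : 0 < σ ^ 2 := by positivity
  have ht0' : 0 < t := ht0
  simp
  nlinarith [mul_pos ht0' this]

/-- If a domain cut along a segment falls into the open pieces `V₁` and `V₂`, then each side of the
segment lies in one of them. -/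
lemma side_subset_or {Ω V₁ V₂ : Set Plane} (hΩ : IsOpen Ω) (hpq : p ≠ q)
    (hs : openSegment ℝ p q ⊆ Ω) (h₁ : IsOpen V₁) (h₂ : IsOpen V₂) (hd : Disjoint V₁ V₂)
    (hV : Ω \ segment ℝ p q ⊆ V₁ ∪ V₂) {σ : ℝ} (hσ : σ ≠ 0) :
    (∀ x ∈ openSegment ℝ p q, ∃ ε > 0, Metric.ball x ε ∩ sideOf p q σ ⊆ V₁) ∨
      ∀ x ∈ openSegment ℝ p q, ∃ ε > 0, Metric.ball x ε ∩ sideOf p q σ ⊆ V₂ := by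
  -- Small half discs on the given side are convex, so each lies in one piece. The points of either
  -- kind form open sets, and the open segment is connected.
  let O : Set Plane → Set Plane := fun V => {x | ∃ ε > 0, Metric.ball x ε ∩ sideOf p q σ ⊆ V}
  have hO : ∀ V, IsOpen (O V) := by
    intro V
    rw [Metric.isOpen_iff]
    rintro x ⟨ε, hε, h⟩
    refine ⟨ε / 2, by positivity, fun y hy => ⟨ε / 2, by positivity, ?_⟩⟩
    refine (Set.inter_subset_inter_left _ (Metric.ball_subset_ball' ?_)).trans h
    rw [Metric.mem_ball] at hy
    linarith
  have hcov : openSegment ℝ p q ⊆ O V₁ ∪ O V₂ := by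
    intro x hx
    obtain ⟨ε, hε, hεΩ⟩ := Metric.isOpen_iff.1 hΩ x (hs hx)
    have hsub : Metric.ball x ε ∩ sideOf p q σ ⊆ V₁ ∪ V₂ := fun z hz =>
      hV ⟨hεΩ hz.1, (disjoint_sideOf_segment hpq σ).notMem_of_mem_left hz.2⟩
    have hpre : IsPreconnected (Metric.ball x ε ∩ sideOf p q σ) :=
      ((convex_ball x ε).inter (convex_sideOf hpq σ)).isPreconnected
    rcases hpre.subset_or_subset h₁ h₂ hd hsub with h | h
    exacts [Or.inl ⟨ε, hε, h⟩, Or.inr ⟨ε, hε, h⟩]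
  have hdis : openSegment ℝ p q ∩ (O V₁ ∩ O V₂) = ∅ := by
    rw [Set.eq_empty_iff_forall_notMem]
    rintro x ⟨hx, ⟨ε₁, hε₁, h1⟩, ε₂, hε₂, h2⟩
    obtain ⟨z, hz, hz'⟩ := exists_mem_ball_sideOf hpq hσ hx (lt_min hε₁ hε₂)
    refine hd.notMem_of_mem_left (h1 ⟨?_, hz'⟩) (h2 ⟨?_, hz'⟩)
    · exact Metric.ball_subset_ball (min_le_left _ _) hz
    · exact Metric.ball_subset_ball (min_le_right _ _) hz
  exact isPreconnected_iff_subset_of_disjoint.1 (convex_openSegment p q).isPreconnected _ _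
    (hO _) (hO _) hcov hdis

lemma exists_ball_im_eq_zero (hpq : p ≠ q) {x : Plane} (hx : x ∈ openSegment ℝ p q) :
    ∃ ε > 0, ∀ z ∈ Metric.ball x ε, 0 < (segCoord p q z).re ∧ (segCoord p q z).re < 1 := by
  obtain ⟨t, h0, h1, ht⟩ := (mem_openSegment_iff_segCoord hpq).1 hx
  have hc : Continuous fun z => (segCoord p q z).re :=
    Complex.continuous_re.comp continuous_segCoord
  have : {z : Plane | 0 < (segCoord p q z).re ∧ (segCoord p q z).re < 1} ∈ 𝓝 x := by
    refine ((isOpen_lt continuous_const hc).inter (isOpen_lt hc continuous_const)).mem_nhds ?_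
    constructor <;> simp [ht, h0, h1]
  exact Metric.mem_nhds_iff.1 this

lemma mem_openSegment_of_im_eq_zero (hpq : p ≠ q) {z : Plane} (h0 : 0 < (segCoord p q z).re)
    (h1 : (segCoord p q z).re < 1) (him : (segCoord p q z).im = 0) : z ∈ openSegment ℝ p q :=
  (mem_openSegment_iff_segCoord hpq).2 ⟨_, h0, h1, Complex.ext (by simp) (by simp [him])⟩

/-- A segment joining the two components of the complement of a domain does not separate its two
sides. -/
lemma false_of_sides_separated {Ω K U V₁ V₂ : Set Plane} (hK : IsCompact K) (hU : IsClosed U)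
    (hKU : Disjoint K U) (hΩc : Ωᶜ = K ∪ U) (hp : p ∈ K) (hq : q ∈ U)
    (h₁ : IsOpen V₁) (h₂ : IsOpen V₂) (hd : Disjoint V₁ V₂)
    (hV : Ω \ segment ℝ p q = V₁ ∪ V₂)
    (hup : ∀ x ∈ openSegment ℝ p q, ∃ ε > 0, Metric.ball x ε ∩ sideOf p q 1 ⊆ V₁)
    (hlow : ∀ x ∈ openSegment ℝ p q, ∃ ε > 0, Metric.ball x ε ∩ sideOf p q (-1) ⊆ V₂) : False := by
  classical
  have hpq : p ≠ q := fun h => hKU.notMem_of_mem_left hp (h ▸ hq)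
  have hpΩ : p ∉ Ω := by change p ∈ Ωᶜ; rw [hΩc]; exact Or.inl hp
  have hqΩ : q ∉ Ω := by change q ∈ Ωᶜ; rw [hΩc]; exact Or.inr hq
  let ξ := segCoord p q
  have hξc : Continuous ξ := continuous_segCoord
  have hξ0 : ∀ z ∈ Ω, ξ z ≠ 0 := fun z hz h =>
    hpΩ ((segCoord_injective hpq (h.trans (segCoord_self hpq).1.symm)) ▸ hz)
  have hξ1 : ∀ z ∈ Ω, ξ z - 1 ≠ 0 := fun z hz h =>
    hqΩ ((segCoord_injective hpq ((sub_eq_zero.1 h).trans (segCoord_self hpq).2.symm)) ▸ hz)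
  -- On `Ω`, `w` is a negative real exactly on the segment, so the principal logarithm of `w` jumps
  -- by `2πi` only there. If the sides lie in different pieces, adding `2πi` on `V₁` repairs the
  -- jump. Then `z - p` is `z - q` times an exponential on `Ω`, while `z - q` has no zero on `Ω ∪
  -- K`: the excluded factorisation.
  let w : Plane → ℂ := fun z => ξ z / (ξ z - 1)
  have hwc : ∀ z ∈ Ω, ContinuousAt w z := fun z hz =>
    hξc.continuousAt.div (hξc.sub continuous_const).continuousAt (hξ1 z hz)
  have hw0 : ∀ z ∈ Ω, w z ≠ 0 := fun z hz => div_ne_zero (hξ0 z hz) (hξ1 z hz)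
  have hwim : ∀ z, (w z).im = -(ξ z).im / Complex.normSq (ξ z - 1) := by
    intro z
    simp only [w, Complex.div_im, Complex.sub_re, Complex.sub_im, Complex.one_re, Complex.one_im]
    ring
  have hwre : ∀ z, (w z).re =
      ((ξ z).re * ((ξ z).re - 1) + (ξ z).im ^ 2) / Complex.normSq (ξ z - 1) := by
    intro z
    simp only [w, Complex.div_re, Complex.sub_re, Complex.sub_im, Complex.one_re, Complex.one_im]
    ring
  have hpos : ∀ z ∈ Ω, 0 < Complex.normSq (ξ z - 1) := fun z hz =>
    Complex.normSq_pos.2 (hξ1 z hz)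
  have hslit : ∀ z ∈ Ω, z ∉ segment ℝ p q → w z ∈ Complex.slitPlane := by
    intro z hz hzs
    rw [Complex.mem_slitPlane_iff]
    by_contra! hcon
    obtain ⟨hre, him⟩ := hcon
    rw [hwim, div_eq_zero_iff, neg_eq_zero] at him
    have him := him.resolve_right (hpos z hz).ne'
    rw [hwre, him] at hre
    have hre := (div_nonpos_iff.1 hre).resolve_left (fun h => h.2.not_gt (hpos z hz))
    refine hzs ((mem_segment_iff_segCoord hpq).2 ⟨(ξ z).re, ?_, ?_,
      Complex.ext (by simp [ξ]) (by simp [ξ] at him ⊢; exact him)⟩) <;> nlinarith [hre.1]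
  let F : Plane → ℂ := fun z => Complex.log (w z) + if z ∈ V₁ then 2 * Real.pi * Complex.I else 0
  have hFexp : ∀ z ∈ Ω, Complex.exp (F z) = w z := by
    intro z hz
    simp only [F]
    split_ifs
    · rw [Complex.exp_add, Complex.exp_two_pi_mul_I, mul_one, Complex.exp_log (hw0 z hz)]
    · rw [add_zero, Complex.exp_log (hw0 z hz)]
  have hVΩ : ∀ z ∈ V₁ ∪ V₂, z ∈ Ω ∧ z ∉ segment ℝ p q := fun z hz => by
    rw [← hV] at hz; exact hz
  have hFc : ContinuousOn F Ω := by
    intro z hz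
    refine ContinuousAt.continuousWithinAt ?_
    by_cases hzs : z ∈ segment ℝ p q
    · have hzo : z ∈ openSegment ℝ p q := by
        refine mem_openSegment_of_ne_left_right ?_ ?_ hzs
        · rintro rfl; exact hpΩ hz
        · rintro rfl; exact hqΩ hz
      have hΩo : IsOpen Ω := by
        rw [← isClosed_compl_iff, hΩc]; exact hK.isClosed.union hU
      obtain ⟨ε₁, hε₁, hb₁⟩ := hup z hzo
      obtain ⟨ε₂, hε₂, hb₂⟩ := hlow z hzo
      obtain ⟨ε₃, hε₃, hb₃⟩ := exists_ball_im_eq_zero hpq hzo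
      -- Near the segment `F` coincides with this branch, because `-w` is close to the positive
      -- axis.
      have hcl : ContinuousAt (fun y => Complex.log (-w y) + Real.pi * Complex.I) z := by
        refine ContinuousAt.add (ContinuousAt.clog (hwc z hz).neg ?_) continuousAt_const
        obtain ⟨t, ht0, ht1, ht⟩ := (mem_openSegment_iff_segCoord hpq).1 hzo
        refine Complex.mem_slitPlane_iff.2 (Or.inl ?_)
        rw [Complex.neg_re, hwre, show ξ z = t from ht, ← neg_div]
        refine div_pos ?_ (ht ▸ hpos z hz)
        simp
        nlinarith
      refine hcl.congr ?_
      filter_upwards [Metric.ball_mem_nhds z hε₁, Metric.ball_mem_nhds z hε₂,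
        Metric.ball_mem_nhds z hε₃, hΩo.mem_nhds hz] with y y1 y2 y3 yΩ
      have hlog : ∀ v : ℂ, Complex.log v = Real.log ‖v‖ + Complex.arg v * Complex.I := fun v => rfl
      rcases lt_trichotomy (ξ y).im 0 with him | him | him
      · have hy2 : y ∈ V₂ := hb₂ ⟨y2, by change 0 < -1 * (ξ y).im; linarith⟩
        have hy1 : y ∉ V₁ := hd.notMem_of_mem_right hy2
        have : 0 < (w y).im := by rw [hwim]; exact div_pos (by linarith) (hpos y yΩ)
        simp only [F, hy1, if_false, add_zero, hlog, norm_neg]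
        rw [Complex.arg_neg_eq_arg_sub_pi_of_im_pos this]
        push_cast; ring
      · have hyo := mem_openSegment_of_im_eq_zero hpq (hb₃ y y3).1 (hb₃ y y3).2 him
        have hy1 : y ∉ V₁ := fun h =>
          (hVΩ y (Or.inl h)).2 (openSegment_subset_segment ℝ p q hyo)
        have h1 : (w y).im = 0 := by rw [hwim, him]; simp
        have h2 : (w y).re < 0 := by
          rw [hwre, him]
          refine div_neg_of_neg_of_pos ?_ (hpos y yΩ)
          have := hb₃ y y3
          change 0 < (ξ y).re ∧ (ξ y).re < 1 at this
          nlinarith [this.1, this.2]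
        simp only [F, hy1, if_false, add_zero, hlog, norm_neg]
        rw [Complex.arg_neg_eq_arg_sub_pi_iff.2 (Or.inr ⟨h1, h2⟩)]
        push_cast; ring
      · have hy1 : y ∈ V₁ := hb₁ ⟨y1, by change 0 < 1 * (ξ y).im; linarith⟩
        have : (w y).im < 0 := by
          rw [hwim]; exact div_neg_of_neg_of_pos (by linarith) (hpos y yΩ)
        simp only [F, hy1, if_true, hlog, norm_neg]
        rw [Complex.arg_neg_eq_arg_add_pi_of_im_neg this]
        push_cast; ring
    · have hz12 : z ∈ V₁ ∪ V₂ := hV ▸ ⟨hz, hzs⟩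
      have hlogc : ContinuousAt (fun y => Complex.log (w y)) z := (hwc z hz).clog (hslit z hz hzs)
      refine hlogc.add ?_
      rcases hz12 with hz1 | hz2
      · refine (continuousAt_const (y := (2 * Real.pi * Complex.I : ℂ))).congr ?_
        filter_upwards [h₁.mem_nhds hz1] with y hy
        rw [if_pos hy]
      · refine (continuousAt_const (y := (0 : ℂ))).congr ?_
        filter_upwards [h₂.mem_nhds hz2] with y hy
        rw [if_neg (hd.notMem_of_mem_right hy)]
  have hΩK : Ω ∪ K = Uᶜ := by
    rw [← compl_compl Ω, hΩc]
    ext z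
    have : z ∈ K → z ∉ U := fun hk => hKU.notMem_of_mem_left hk
    simp only [Set.mem_union, Set.mem_compl_iff]
    tauto
  refine false_of_exp_factor (W := Ω) (K := K) (m := fun z => toC (z - q)) (F := F) hK ?_
    (hΩK ▸ hU.isOpen_compl) hp (by fun_prop) (fun z hz => ?_) hFc (fun z hz => ?_)
  · rw [Set.disjoint_right]
    intro z hzK
    change z ∈ Ωᶜ
    rw [hΩc]; exact Or.inl hzK
  · rw [Ne, LinearIsometryEquiv.map_eq_zero_iff, sub_eq_zero]
    rintro rfl
    rw [hΩK] at hz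
    exact hz hq
  · rw [hFexp z hz]
    have h1 := toC_sub_ne_zero hpq
    have h2 : toC (z - q) = (ξ z - 1) * toC (q - p) := by
      simp only [ξ, segCoord, sub_mul, div_mul_cancel₀ _ h1, one_mul, ← map_sub]
      congr 1; abel
    have h3 : toC (z - p) = ξ z * toC (q - p) := by
      simp only [ξ, segCoord, div_mul_cancel₀ _ h1]
    have h4 := hξ1 z hz
    rw [h2, h3]
    simp only [w]
    field_simp

/-- Cutting a doubly connected domain along a segment that joins the two components of its
complement leaves it connected. -/
theorem isPreconnected_diff_segment {Ω K U : Set Plane} (hΩ : IsConnected Ω) (hK : IsCompact K)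
    (hU : IsClosed U) (hKU : Disjoint K U) (hΩc : Ωᶜ = K ∪ U) (hp : p ∈ K) (hq : q ∈ U)
    (hs : openSegment ℝ p q ⊆ Ω) : IsPreconnected (Ω \ segment ℝ p q) := by
  have hpq : p ≠ q := fun h => hKU.notMem_of_mem_left hp (h ▸ hq)
  have hpΩ : p ∉ Ω := by change p ∈ Ωᶜ; rw [hΩc]; exact Or.inl hp
  have hqΩ : q ∉ Ω := by change q ∈ Ωᶜ; rw [hΩc]; exact Or.inr hq
  have hΩo : IsOpen Ω := by
    rw [← isClosed_compl_iff, hΩc]; exact hK.isClosed.union hU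
  have hWo : IsOpen (Ω \ segment ℝ p q) := by
    refine hΩo.sdiff ?_
    rw [← convexHull_pair]
    exact (Set.toFinite {p, q}).isClosed_convexHull ℝ
  rw [isPreconnected_iff_subset_of_disjoint]
  intro u v hu hv huv hdis
  set W := Ω \ segment ℝ p q with hWdef
  have h₁ : IsOpen (W ∩ u) := hWo.inter hu
  have h₂ : IsOpen (W ∩ v) := hWo.inter hv
  have hV : W = W ∩ u ∪ W ∩ v := by
    rw [← Set.inter_union_distrib_left]; exact (Set.inter_eq_left.2 huv).symm
  have hd : Disjoint (W ∩ u) (W ∩ v) := by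
    rw [Set.disjoint_iff_inter_eq_empty, ← Set.inter_inter_distrib_left]; exact hdis
  -- both sides in the same piece
  have same : ∀ V V' : Set Plane, IsOpen V → IsOpen V' → Disjoint V V' → W = V ∪ V' →
      (∀ x ∈ openSegment ℝ p q, ∃ ε > 0, Metric.ball x ε ∩ sideOf p q 1 ⊆ V) →
      (∀ x ∈ openSegment ℝ p q, ∃ ε > 0, Metric.ball x ε ∩ sideOf p q (-1) ⊆ V) → V' = ∅ := by
    intro V V' hVo hV'o hVV' hWV hup hlow
    by_contra hne
    have hne := Set.nonempty_iff_ne_empty.2 hne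
    -- Putting the open segment back into `V` keeps it open, and together with a nonempty `V'` it
    -- would disconnect `Ω`.
    have hVs : IsOpen (V ∪ openSegment ℝ p q) := by
      rw [isOpen_iff_mem_nhds]
      rintro x (hx | hx)
      · exact mem_of_superset (hVo.mem_nhds hx) Set.subset_union_left
      · obtain ⟨ε₁, hε₁, hb₁⟩ := hup x hx
        obtain ⟨ε₂, hε₂, hb₂⟩ := hlow x hx
        obtain ⟨ε₃, hε₃, hb₃⟩ := exists_ball_im_eq_zero hpq hx
        filter_upwards [Metric.ball_mem_nhds x hε₁, Metric.ball_mem_nhds x hε₂,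
          Metric.ball_mem_nhds x hε₃] with y y1 y2 y3
        rcases lt_trichotomy (segCoord p q y).im 0 with him | him | him
        · exact Or.inl (hb₂ ⟨y2, by change 0 < -1 * (segCoord p q y).im; linarith⟩)
        · exact Or.inr (mem_openSegment_of_im_eq_zero hpq (hb₃ y y3).1 (hb₃ y y3).2 him)
        · exact Or.inl (hb₁ ⟨y1, by change 0 < 1 * (segCoord p q y).im; linarith⟩)
    have hm := openSegment_subset_segment ℝ p q
    have hV'W : V' ⊆ W := hWV ▸ Set.subset_union_right
    obtain ⟨m, hmo⟩ : (openSegment ℝ p q).Nonempty := by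
      exact ⟨_, 1 / 2, 1 / 2, by norm_num, by norm_num, by norm_num, rfl⟩
    obtain ⟨y, hy, hyV, hyV'⟩ := hΩ.isPreconnected _ _ hVs hV'o (by
      intro z hz
      by_cases hzs : z ∈ segment ℝ p q
      · refine Or.inl (Or.inr (mem_openSegment_of_ne_left_right ?_ ?_ hzs))
        · rintro rfl; exact hpΩ hz
        · rintro rfl; exact hqΩ hz
      · have : z ∈ V ∪ V' := hWV ▸ ⟨hz, hzs⟩
        rcases this with h | h
        exacts [Or.inl (Or.inl h), Or.inr h])
      ⟨m, hs hmo, Or.inr hmo⟩ (hne.imp fun z hz => ⟨(hV'W hz).1, hz⟩)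
    rcases hyV with h | h
    · exact hVV'.notMem_of_mem_left h hyV'
    · exact (hV'W hyV').2 (hm h)
  have concl : (W ∩ u = ∅ ∨ W ∩ v = ∅) → W ⊆ u ∨ W ⊆ v := by
    rintro (h | h) <;> rw [h] at hV
    · rw [Set.empty_union] at hV
      exact Or.inr (Set.inter_eq_left.1 hV.symm)
    · rw [Set.union_empty] at hV
      exact Or.inl (Set.inter_eq_left.1 hV.symm)
  apply concl
  rcases side_subset_or hΩo hpq hs h₁ h₂ hd hV.subset one_ne_zero with hup | hup <;>
  rcases side_subset_or hΩo hpq hs h₁ h₂ hd hV.subset (neg_ne_zero.2 one_ne_zero) with hlow | hlow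
  · exact Or.inr (same _ _ h₁ h₂ hd hV hup hlow)
  · exact (false_of_sides_separated hK hU hKU hΩc hp hq h₁ h₂ hd hV hup hlow).elim
  · exact (false_of_sides_separated hK hU hKU hΩc hp hq h₂ h₁ hd.symm
      (hV.trans (Set.union_comm _ _)) hup hlow).elim
  · exact Or.inl (same _ _ h₂ h₁ hd.symm (hV.trans (Set.union_comm _ _)) hup hlow)

end Segment

/-! ### The optimal cut -/

lemma isCompact_segment_plane (p q : Plane) : IsCompact (segment ℝ p q) := by
  rw [← convexHull_pair]
  exact (Set.toFinite {p, q}).isCompact_convexHull ℝ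

lemma dist_le_of_mem_segment {p q x y : Plane} (hx : x ∈ segment ℝ p q)
    (hy : y ∈ segment ℝ p q) : dist x y ≤ dist p q := by
  rw [← convexHull_pair] at hx hy
  have h := Metric.dist_le_diam_of_mem (isBounded_convexHull.2 (Set.toFinite {p, q}).isBounded) hx hy
  rwa [convexHull_diam, Metric.diam_pair] at h

/-- A cut that makes a doubly connected domain simply connected meets both components of the
complement. -/
lemma segment_inter_nonempty {Ω K U : Set Plane} (hΩ : IsOpen Ω) (hK : IsCompact K)
    (hKn : K.Nonempty) (hU : IsClosed U) (hKU : Disjoint K U) (hΩc : Ωᶜ = K ∪ U) {p q : Plane}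
    (h : IsSimplyConnected (Ω \ segment ℝ p q)) :
    (segment ℝ p q ∩ K).Nonempty ∧ (segment ℝ p q ∩ U).Nonempty := by
  have hs := isCompact_segment_plane p q
  have hWo : IsOpen (Ω \ segment ℝ p q) := hΩ.sdiff hs.isClosed
  have key : ∀ z, (z ∈ Ω ↔ z ∉ K ∧ z ∉ U) ∧ (z ∈ K → z ∉ U) := fun z => by
    have h1 : z ∈ Ωᶜ ↔ z ∈ K ∪ U := by rw [hΩc]
    simp only [Set.mem_compl_iff, Set.mem_union] at h1
    exact ⟨by tauto, fun hk => hKU.notMem_of_mem_left hk⟩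
  -- A cut that misses `K` leaves a set surrounding `K`; a cut that misses `U` leaves one
  -- surrounding `K ∪ segment ℝ p q`.
  constructor <;> rw [Set.nonempty_iff_ne_empty] <;> intro he
  · have he' : ∀ z, z ∈ segment ℝ p q → z ∉ K := fun z h1 h2 =>
      Set.notMem_empty z (he ▸ ⟨h1, h2⟩)
    refine false_of_isSimplyConnected_of_surround hK hKn ?_ ?_ hWo h
    · rw [Set.disjoint_left]
      intro z hz
      exact ((key z).1.1 hz.1).1
    · have : (Ω \ segment ℝ p q) ∪ K = (U ∪ segment ℝ p q)ᶜ := by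
        ext z
        have := key z; have := he' z
        simp only [Set.mem_union, Set.mem_sdiff, Set.mem_compl_iff]
        tauto
      rw [this]
      exact (hU.union hs.isClosed).isOpen_compl
  · have he' : ∀ z, z ∈ segment ℝ p q → z ∉ U := fun z h1 h2 =>
      Set.notMem_empty z (he ▸ ⟨h1, h2⟩)
    refine false_of_isSimplyConnected_of_surround (hK.union hs) (hKn.mono Set.subset_union_left)
      ?_ ?_ hWo h
    · rw [Set.disjoint_left]
      rintro z hz (hz' | hz')
      exacts [((key z).1.1 hz.1).1 hz', hz.2 hz']
    · have : (Ω \ segment ℝ p q) ∪ (K ∪ segment ℝ p q) = Uᶜ := by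
        ext z
        have := key z; have := he' z
        simp only [Set.mem_union, Set.mem_sdiff, Set.mem_compl_iff]
        tauto
      rw [this]
      exact hU.isOpen_compl

/-- The shortest segment between the two components of the complement is an optimal cut of a doubly
connected domain. -/
theorem IsDoublyConnectedDomain.exists_optimal_cut {Ω : Set Plane}
    (hΩ : IsDoublyConnectedDomain Ω) :
    ∃ p q : Plane, p ≠ q ∧ IsSimplyConnected (Ω \ segment ℝ p q) ∧
      cheegerCut Ω = dist p q ∧ minWidth Ω = dist p q ∧ IsLeast (cutLengths Ω) (dist p q) := by
  obtain ⟨K, U, hholes, hK, hKc, hU, hUc, hKU, hΩc⟩ := hΩ.exists_components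
  obtain ⟨p, hp, q, hq, hmin⟩ := exists_nearest_points hK hKc.nonempty hU hUc.nonempty
  have hpq : p ≠ q := fun h => hKU.notMem_of_mem_left hp (h ▸ hq)
  have hos : openSegment ℝ p q ⊆ Ω := by
    intro x hx
    by_contra hxΩ
    have hx' : x ∈ K ∪ U := hΩc ▸ hxΩ
    have hd := dist_add_dist_of_mem_segment (openSegment_subset_segment ℝ p q hx)
    have hpx : p ≠ x := by rintro rfl; exact hpq (left_mem_openSegment_iff.1 hx)
    have hqx : x ≠ q := by rintro rfl; exact hpq (right_mem_openSegment_iff.1 hx)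
    rcases hx' with hxK | hxU
    · have := hmin x hxK q hq
      linarith [dist_pos.2 hpx]
    · have := hmin p hp x hxU
      linarith [dist_pos.2 hqx]
  have hseg : segment ℝ p q ⊆ closure (openSegment ℝ p q) := segment_subset_closure_openSegment
  have hsc : IsSimplyConnected (Ω \ segment ℝ p q) := by
    have hWo : IsOpen (Ω \ segment ℝ p q) :=
      hΩ.isOpen.sdiff (isCompact_segment_plane p q).isClosed
    refine isSimplyConnected_of_isPreconnected_compl hWo (hΩ.isBounded.subset Set.sdiff_subset)
      ⟨?_, isPreconnected_diff_segment hΩ.isConnected hK hU hKU hΩc hp hq hos⟩ ?_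
    · obtain ⟨x, hx⟩ : (openSegment ℝ p q).Nonempty :=
        ⟨_, 1 / 2, 1 / 2, by norm_num, by norm_num, by norm_num, rfl⟩
      obtain ⟨ε, hε, hb⟩ := Metric.isOpen_iff.1 hΩ.isOpen x (hos hx)
      obtain ⟨z, hz, hzs⟩ := exists_mem_ball_sideOf hpq one_ne_zero hx hε
      exact ⟨z, hb hz, (disjoint_sideOf_segment hpq 1).notMem_of_mem_left hzs⟩
    · have : (Ω \ segment ℝ p q)ᶜ = K ∪ segment ℝ p q ∪ U := by
        rw [Set.sdiff_eq, Set.compl_inter, compl_compl, hΩc, Set.union_right_comm]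
      rw [this]
      refine (hKc.isPreconnected.union p hp (left_mem_segment ℝ p q)
        (convex_segment p q).isPreconnected).union q (Or.inr (right_mem_segment ℝ p q)) hq
        hUc.isPreconnected
  have hleast : IsLeast (cutLengths Ω) (dist p q) := by
    have hn : numHoles Ω = 1 := hΩ.one_hole
    constructor
    · refine ⟨fun _ => p, fun _ => q, ?_, ?_⟩
      · have : Nonempty (Fin (numHoles Ω)) := by rw [hn]; infer_instance
        rwa [Set.iUnion_const]
      · simp [hn]
    · rintro l ⟨p', q', hsc', rfl⟩
      have : Unique (Fin (numHoles Ω)) := by rw [hn]; infer_instance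
      rw [show (⋃ j, segment ℝ (p' j) (q' j)) = segment ℝ (p' default) (q' default) from
        iSup_unique _] at hsc'
      rw [Fintype.sum_unique]
      obtain ⟨⟨x, hxs, hxK⟩, y, hys, hyU⟩ :=
        segment_inter_nonempty hΩ.isOpen hK hKc.nonempty hU hKU hΩc hsc'
      exact (hmin x hxK y hyU).trans (dist_le_of_mem_segment hxs hys)
  refine ⟨p, q, hpq, hsc, hleast.csInf_eq, ?_, hleast⟩
  -- The nearest points are boundary points, being limits of points of the open segment, which lies
  -- in `Ω`.
  have hfr : ∀ (C : Set Plane) (x : Plane), IsClosed C → C ⊆ Ωᶜ → x ∈ C → x ∈ segment ℝ p q →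
      x ∈ frontier C := by
    intro C x hC hCΩ hxC hxs
    rw [hC.frontier_eq]
    refine ⟨hxC, fun hxi => ?_⟩
    obtain ⟨z, hz, hzo⟩ := mem_closure_iff.1 (hseg hxs) _ isOpen_interior hxi
    exact hCΩ (interior_subset hz) (hos hzo)
  have hin : innerBoundary Ω = frontier K := by rw [innerBoundary, hholes, Set.sUnion_singleton]
  have hout : outerBoundary Ω = frontier U := by
    rw [outerBoundary, hholes, Set.sUnion_singleton, hΩc, Set.union_sdiff_left,
      hKU.symm.sdiff_eq_left]
  refine IsLeast.csInf_eq ⟨⟨p, ?_, q, ?_, rfl⟩, ?_⟩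
  · rw [hin]
    exact hfr K p hK.isClosed (hΩc ▸ Set.subset_union_left) hp (left_mem_segment ℝ p q)
  · rw [hout]
    exact hfr U q hU (hΩc ▸ Set.subset_union_right) hq (right_mem_segment ℝ p q)
  · rintro d ⟨x, hx, y, hy, rfl⟩
    rw [hin] at hx
    rw [hout] at hy
    exact hmin x (hK.isClosed.frontier_subset hx) y (hU.frontier_subset hy)

/-! ### The logarithmic cut-off -/

/-- A smoothed logarithmic cut-off, as a function of the squared radius: it vanishes up to the
radius `exp (-0.9 ℓ)`, is one from the radius `exp (-0.5 ℓ)` on, and has small Dirichlet energy. -/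
lemma exists_log_cutoff {ℓ : ℝ} (hℓ : 0 < ℓ) :
    ∃ σ k : ℝ → ℝ, Continuous k ∧ (∀ s, HasDerivAt σ (k s) s) ∧
      (∀ s ≤ Real.exp (-(9 / 5 * ℓ)), σ s = 0 ∧ k s = 0) ∧ (∀ s, Real.exp (-ℓ) ≤ s → σ s = 1) ∧
      (∀ s, 0 ≤ σ s ∧ σ s ≤ 1) ∧ (∀ s, Real.exp (-ℓ) ≤ s → k s = 0) ∧
      ∫ y in Set.Ioi (0 : ℝ), y * (4 * y ^ 2 * k (y ^ 2) ^ 2) = 3 / ℓ := by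
  set s₀ := Real.exp (-(9 / 5 * ℓ)) with hs₀
  set s₁ := Real.exp (-ℓ) with hs₁
  have hs₀0 : 0 < s₀ := Real.exp_pos _
  have hs01 : s₀ < s₁ := Real.exp_lt_exp.2 (by linarith)
  -- With `x = log s = 2 log r`, `T` runs from 0 to 1 as `log r` runs from `-0.9 ℓ` to `-0.5 ℓ`.
  -- Between these radii `k` is the derivative of `3 T² - 2 T³`, which makes the cut-off
  -- continuously differentiable. `max s s₀` keeps the logarithm continuous.
  let T : ℝ → ℝ := fun x => (x / 2 + 9 / 10 * ℓ) / (2 / 5 * ℓ)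
  let t : ℝ → ℝ := fun s => T (Real.log (max s s₀))
  let k : ℝ → ℝ := fun s => 6 * max 0 (t s * (1 - t s)) / (4 / 5 * ℓ * max s s₀)
  have hmax : ∀ s, 0 < max s s₀ := fun s => lt_max_of_lt_right hs₀0
  have htc : Continuous t := by
    have : Continuous fun s => Real.log (max s s₀) :=
      Continuous.log (by fun_prop) fun s => (hmax s).ne'
    simp only [t, T]
    fun_prop
  have hk : Continuous k := by
    refine Continuous.div (by fun_prop) (by fun_prop) fun s => ?_
    have := hmax s
    positivity
  have hk0 : ∀ s, 0 ≤ k s := fun s => by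
    have := hmax s
    have := le_max_left 0 (t s * (1 - t s))
    positivity
  have ht0 : ∀ s ≤ s₀, t s = 0 := by
    intro s hs
    have hl : Real.log s₀ = -(9 / 5 * ℓ) := Real.log_exp _
    simp only [t, T, max_eq_right hs, hl]
    rw [div_eq_zero_iff]; left; ring
  have hk_low : ∀ s ≤ s₀, k s = 0 := fun s hs => by simp [k, ht0 s hs]
  have hlog_hi : ∀ s, s₁ ≤ s → -ℓ ≤ Real.log s := fun s hs => by
    rwa [Real.le_log_iff_exp_le (hs₀0.trans (hs01.trans_le hs))]
  have hk_hi : ∀ s, s₁ ≤ s → k s = 0 := by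
    intro s hs
    have h1 : max s s₀ = s := max_eq_left (hs01.le.trans hs)
    have h2 : 1 ≤ t s := by
      simp only [t, T, h1]
      rw [le_div_iff₀ (by positivity)]
      linarith [hlog_hi s hs]
    have h3 : max 0 (t s * (1 - t s)) = 0 := max_eq_left (by nlinarith)
    simp [k, h3]
  have hT01 : ∀ x, -(9 / 5 * ℓ) ≤ x → x ≤ -ℓ → 0 ≤ T x ∧ T x ≤ 1 := by
    intro x h1 h2
    constructor
    · exact div_nonneg (by linarith) (by positivity)
    · simp only [T]
      rw [div_le_one (by positivity)]
      linarith
  have hkmid : ∀ s, s₀ ≤ s → s ≤ s₁ →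
      k s = 6 * (T (Real.log s) * (1 - T (Real.log s))) / (4 / 5 * ℓ * s) := by
    intro s h1 h2
    have h0 : 0 < s := hs₀0.trans_le h1
    have h3 : -(9 / 5 * ℓ) ≤ Real.log s := (Real.le_log_iff_exp_le h0).2 h1
    have h4 : Real.log s ≤ -ℓ := (Real.log_le_iff_le_exp h0).2 h2
    obtain ⟨h5, h6⟩ := hT01 _ h3 h4
    simp only [k, t, max_eq_left h1]
    rw [max_eq_right (mul_nonneg h5 (by linarith))]
  let σ : ℝ → ℝ := fun s => ∫ x in (0 : ℝ)..s, k x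
  have hσ : ∀ s, HasDerivAt σ (k s) s := fun s => (hk.integral_hasStrictDerivAt 0 s).hasDerivAt
  have hint : ∀ a b, IntervalIntegrable k volume a b := fun a b => hk.intervalIntegrable a b
  have hσ_low : ∀ s ≤ s₀, σ s = 0 := by
    intro s hs
    simp only [σ]
    rw [intervalIntegral.integral_congr (g := fun _ => 0), intervalIntegral.integral_zero]
    intro x hx
    refine hk_low x ?_
    have := hx.2
    exact this.trans (max_le hs₀0.le hs)
  have hT0 : T (Real.log s₀) = 0 := by simpa [t] using ht0 s₀ le_rfl
  have hT1 : T (Real.log s₁) = 1 := by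
    simp only [T, hs₁, Real.log_exp]
    rw [div_eq_one_iff_eq (by positivity)]
    ring
  have hσ₁ : σ s₁ = 1 := by
    have h1 : σ s₁ = σ s₀ + ∫ x in s₀..s₁, k x :=
      (intervalIntegral.integral_add_adjacent_intervals (hint _ _) (hint _ _)).symm
    have h2 : ∫ x in s₀..s₁, k x =
        (3 * T (Real.log s₁) ^ 2 - 2 * T (Real.log s₁) ^ 3) -
          (3 * T (Real.log s₀) ^ 2 - 2 * T (Real.log s₀) ^ 3) := by
      refine intervalIntegral.integral_eq_sub_of_hasDerivAt
        (f := fun s => 3 * T (Real.log s) ^ 2 - 2 * T (Real.log s) ^ 3) (fun s hs => ?_) (hint _ _)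
      rw [Set.uIcc_of_le hs01.le] at hs
      have h0 : 0 < s := hs₀0.trans_le hs.1
      have hT : HasDerivAt (fun s => T (Real.log s)) (s⁻¹ / 2 / (2 / 5 * ℓ)) s :=
        (((Real.hasDerivAt_log h0.ne').div_const 2).add_const _).div_const _
      refine (((hT.pow 2).const_mul 3).sub ((hT.pow 3).const_mul 2)).congr_deriv ?_
      rw [hkmid s hs.1 hs.2]
      push_cast
      field_simp
      ring
    rw [h1, hσ_low s₀ le_rfl, h2, hT0, hT1]
    norm_num
  have hσ_hi : ∀ s, s₁ ≤ s → σ s = 1 := by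
    intro s hs
    have h1 : σ s = σ s₁ + ∫ x in s₁..s, k x :=
      (intervalIntegral.integral_add_adjacent_intervals (hint _ _) (hint _ _)).symm
    rw [h1, hσ₁, intervalIntegral.integral_congr (g := fun _ => 0), intervalIntegral.integral_zero,
      add_zero]
    intro x hx
    rw [Set.uIcc_of_le hs] at hx
    exact hk_hi x hx.1
  have hmono : Monotone σ := monotone_of_deriv_nonneg (fun s => (hσ s).differentiableAt)
    fun s => by rw [(hσ s).deriv]; exact hk0 s
  refine ⟨σ, k, hk, hσ, fun s hs => ⟨hσ_low s hs, hk_low s hs⟩, hσ_hi, fun s => ⟨?_, ?_⟩, hk_hi, ?_⟩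
  · rw [← hσ_low (min s s₀) (min_le_right _ _)]
    exact hmono (min_le_left _ _)
  · rw [← hσ_hi (max s s₁) (le_max_right _ _)]
    exact hmono (le_max_left _ _)
  set r₀ := Real.exp (-(9 / 10 * ℓ)) with hr₀
  set r₁ := Real.exp (-(1 / 2 * ℓ)) with hr₁
  have hr₀0 : 0 < r₀ := Real.exp_pos _
  have hr01 : r₀ < r₁ := Real.exp_lt_exp.2 (by linarith)
  have hr₀s : r₀ ^ 2 = s₀ := by rw [hr₀, hs₀, ← Real.exp_nat_mul]; congr 1; push_cast; ring
  have hr₁s : r₁ ^ 2 = s₁ := by rw [hr₁, hs₁, ← Real.exp_nat_mul]; congr 1; push_cast; ring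
  have h1 : ∫ y in Set.Ioi (0 : ℝ), y * (4 * y ^ 2 * k (y ^ 2) ^ 2) =
      ∫ y in Set.Ioc r₀ r₁, y * (4 * y ^ 2 * k (y ^ 2) ^ 2) := by
    refine setIntegral_eq_of_subset_of_forall_sdiff_eq_zero measurableSet_Ioi
      (fun y hy => hr₀0.trans hy.1) ?_
    rintro y ⟨hy0, hy⟩
    have hy0' : 0 < y := hy0
    have : k (y ^ 2) = 0 := by
      rcases le_or_gt y r₀ with h | h
      · exact hk_low _ (hr₀s ▸ pow_le_pow_left₀ hy0'.le h 2)
      · have h' : r₁ < y := by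
          by_contra hc
          exact hy ⟨h, not_lt.1 hc⟩
        exact hk_hi _ (hr₁s ▸ pow_le_pow_left₀ (Real.exp_pos _).le h'.le 2)
    simp [this]
  rw [h1, ← intervalIntegral.integral_of_le hr01.le]
  let Q : ℝ → ℝ := fun y => T (2 * Real.log y)
  -- In the variable `Q` the integrand is `36 Q² (1 - Q)²` over `2ℓ/5`. Its integral over `[0, 1]`
  -- is `6/5`, whence `3 / ℓ`.
  have h2 : ∫ y in r₀..r₁, y * (4 * y ^ 2 * k (y ^ 2) ^ 2) =
      (12 * Q r₁ ^ 3 - 18 * Q r₁ ^ 4 + 36 / 5 * Q r₁ ^ 5) / (2 / 5 * ℓ) -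
        (12 * Q r₀ ^ 3 - 18 * Q r₀ ^ 4 + 36 / 5 * Q r₀ ^ 5) / (2 / 5 * ℓ) := by
    refine intervalIntegral.integral_eq_sub_of_hasDerivAt
      (f := fun y => (12 * Q y ^ 3 - 18 * Q y ^ 4 + 36 / 5 * Q y ^ 5) / (2 / 5 * ℓ))
      (fun y hy => ?_) (Continuous.intervalIntegrable (by fun_prop) _ _)
    rw [Set.uIcc_of_le hr01.le] at hy
    have h0 : 0 < y := hr₀0.trans_le hy.1
    have hQ : HasDerivAt Q (2 * y⁻¹ / 2 / (2 / 5 * ℓ)) y :=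
      ((((Real.hasDerivAt_log h0.ne').const_mul 2).div_const 2).add_const _).div_const _
    have := ((((hQ.pow 3).const_mul 12).sub ((hQ.pow 4).const_mul 18)).add
      ((hQ.pow 5).const_mul (36 / 5))).div_const (2 / 5 * ℓ)
    refine this.congr_deriv ?_
    rw [hkmid (y ^ 2) (hr₀s ▸ pow_le_pow_left₀ hr₀0.le hy.1 2)
      (hr₁s ▸ pow_le_pow_left₀ h0.le hy.2 2), Real.log_pow]
    push_cast
    simp only [Q]
    field_simp
    ring
  have hQ0 : Q r₀ = 0 := by
    simp only [Q, T, hr₀, Real.log_exp]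
    rw [div_eq_zero_iff]; left; ring
  have hQ1 : Q r₁ = 1 := by
    simp only [Q, T, hr₁, Real.log_exp]
    rw [div_eq_one_iff_eq (by positivity)]
    ring
  rw [h2, hQ0, hQ1]
  field_simp
  norm_num

/-! ### The test function and the eigenvalue bound -/

/-- A classical partial derivative is a weak partial derivative. -/
lemma isWeakPartial_of_hasLineDerivAt {Ω : Set Plane} {i : Fin 2} {u g : Plane → ℂ}
    (hu : ContinuousOn u Ω) (hg : ContinuousOn g Ω) (hΩ : IsOpen Ω)
    (h : ∀ x ∈ Ω, HasLineDerivAt ℝ u (g x) x (e i)) : IsWeakPartial Ω i u g := by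
  intro φ hφ hφc hφΩ
  have hcont : ∀ (f : Plane → ℝ) (v : Plane → ℂ), Continuous f → tsupport f ⊆ tsupport φ →
      ContinuousOn v Ω → Integrable (fun x => f x • v x) := by
    intro f v hf hfs hv
    have hs : tsupport (fun x => f x • v x) ⊆ tsupport f :=
      closure_mono (Function.support_smul_subset_left f v)
    refine Continuous.integrable_of_hasCompactSupport ?_
      (hφc.of_isClosed_subset (isClosed_tsupport _) (hs.trans hfs))
    refine continuous_of_tsupport fun x hx => ?_
    exact hf.continuousAt.smul (hv.continuousAt (hΩ.mem_nhds (hφΩ (hfs (hs hx)))))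
  have hφ1 : Differentiable ℝ φ := hφ.differentiable (by simp)
  have hφ' : Continuous fun x => fderiv ℝ φ x (e i) :=
    (hφ.continuous_fderiv (by simp)).clm_apply continuous_const
  have hsupp : tsupport (fun x => fderiv ℝ φ x (e i)) ⊆ tsupport φ :=
    tsupport_fderiv_apply_subset ℝ (e i)
  have key := integral_bilinear_hasLineDerivAt_right_eq_neg_left_of_integrable (μ := volume)
    (f := u) (f' := g) (g := φ) (g' := fun x => fderiv ℝ φ x (e i)) (v := e i)
    (B := (ContinuousLinearMap.lsmul ℝ ℝ : ℝ →L[ℝ] ℂ →L[ℝ] ℂ).flip)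
    (by simpa using hcont φ g hφ.continuous subset_rfl hg)
    (by simpa using hcont _ u hφ' hsupp hu)
    (by simpa using hcont φ u hφ.continuous subset_rfl hu)
    (fun x hx => h x (hφΩ hx))
    (fun x _ => (hφ1 x).hasFDerivAt.hasLineDerivAt (e i))
  simp only [ContinuousLinearMap.flip_apply, ContinuousLinearMap.lsmul_apply,
    Complex.real_smul] at key
  rw [setIntegral_eq_integral_of_forall_compl_eq_zero,
    setIntegral_eq_integral_of_forall_compl_eq_zero, key]
  · intro x hx
    rw [image_eq_zero_of_notMem_tsupport fun hs => hx (hφΩ hs)]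
    simp
  · intro x hx
    have : fderiv ℝ φ x (e i) = 0 :=
      image_eq_zero_of_notMem_tsupport (f := fun x => fderiv ℝ φ x (e i))
        fun hs => hx (hφΩ (hsupp hs))
    rw [this]
    simp

/-- The Rayleigh quotient is bounded from below by zero. -/
lemma rayleighQuotients_nonneg {Ω : Set Plane} {A : Plane → (Plane →L[ℝ] ℝ)} {r : ℝ}
    (hr : r ∈ rayleighQuotients Ω A) : 0 ≤ r := by
  obtain ⟨u, g, -, -, rfl⟩ := hr
  refine div_nonneg (integral_nonneg fun x => ?_) (integral_nonneg fun x => by positivity)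
  exact Finset.sum_nonneg fun i _ => by positivity

lemma groundState_nonneg (Ω : Set Plane) (A : Plane → (Plane →L[ℝ] ℝ)) : 0 ≤ groundState Ω A :=
  Real.sInf_nonneg fun _ hr => rayleighQuotients_nonneg hr

lemma integral_radial (f : ℝ → ℝ) (c : Plane) :
    ∫ x : Plane, f ‖x - c‖ = 2 * Real.pi * ∫ y in Set.Ioi (0 : ℝ), y * f y := by
  rw [integral_sub_right_eq_self (fun x : Plane => f ‖x‖) c, integral_fun_norm_addHaar]
  simp only [finrank_euclideanSpace_fin, Measure.real, EuclideanSpace.volume_ball_fin_two]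
  simp [Real.pi_pos.le, mul_assoc]

/-- The eigenvalue bound: if a closed potential is exact off the disc of radius `exp (-ℓ)` about `c`,
then a logarithmic cut-off of its phase is a test function. -/
theorem groundState_le_of_phase {Ω W : Set Plane} (hΩ : IsOpen Ω) (hΩb : Bornology.IsBounded Ω)
    {A : Plane → (Plane →L[ℝ] ℝ)} (hA : ContinuousOn A (closure Ω)) {ψ : Plane → ℝ}
    (hψ : ∀ x ∈ W, HasFDerivAt ψ (A x) x) {c : Plane} {ℓ : ℝ} (hℓ : 0 < ℓ)
    (hW : Ω \ Metric.closedBall c (Real.exp (-ℓ)) ⊆ W)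
    (harea : Real.pi * Real.exp (-ℓ) ≤ area Ω / 4) :
    groundState Ω A ≤ 8 * Real.pi / (area Ω * ℓ) := by
  obtain ⟨σ, k, hk, hσ, hlow, hhi, h01, hkhi, hen⟩ := exists_log_cutoff hℓ
  have hσc : Continuous σ := continuous_iff_continuousAt.2 fun s => (hσ s).continuousAt
  let s : Plane → ℝ := fun x => ‖x - c‖ ^ 2
  have hsc : Continuous s := by fun_prop
  set r₀ := Real.exp (-(9 / 10 * ℓ)) with hr₀
  have hr₀0 : 0 < r₀ := Real.exp_pos _
  have hr₀ℓ : Real.exp (-ℓ) < r₀ := Real.exp_lt_exp.2 (by linarith)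
  have hs_ball : ∀ x ∈ Metric.ball c r₀, s x ≤ Real.exp (-(9 / 5 * ℓ)) := by
    intro x hx
    rw [Metric.mem_ball, dist_eq_norm] at hx
    have : r₀ ^ 2 = Real.exp (-(9 / 5 * ℓ)) := by
      rw [hr₀, ← Real.exp_nat_mul]; congr 1; push_cast; ring
    rw [← this]
    exact pow_le_pow_left₀ (norm_nonneg _) hx.le 2
  let P : Plane → ℂ := fun x => Complex.exp (ψ x * Complex.I)
  have hPn : ∀ x, ‖P x‖ = 1 := fun x => Complex.norm_exp_ofReal_mul_I _
  have hnear : ∀ x ∈ Ω, x ∉ Metric.ball c r₀ → x ∈ W := by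
    intro x hx hxb
    refine hW ⟨hx, fun hxc => hxb ?_⟩
    rw [Metric.mem_closedBall] at hxc
    exact Metric.mem_ball.2 (hxc.trans_lt hr₀ℓ)
  -- The phase is controlled only on `W`. Factors vanishing on the ball of radius `r₀ > exp (-ℓ)`,
  -- which contains the excluded disc, hide its irregularity.
  have hcontP : ∀ F : Plane → ℂ, ContinuousOn F Ω → (∀ x ∈ Metric.ball c r₀, F x = 0) →
      ContinuousOn (fun x => F x * P x) Ω := by
    intro F hF hF0 x hx
    by_cases hxb : x ∈ Metric.ball c r₀
    · refine ((continuousAt_const (y := (0 : ℂ))).congr ?_).continuousWithinAt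
      filter_upwards [Metric.isOpen_ball.mem_nhds hxb] with y hy
      rw [hF0 y hy, zero_mul]
    · have hψx : ContinuousAt ψ x := (hψ x (hnear x hx hxb)).continuousAt
      have : ContinuousAt P x :=
        ((Complex.continuous_ofReal.continuousAt.comp hψx).mul continuousAt_const).cexp
      exact (hF x hx).mul this.continuousWithinAt
  let u : Plane → ℂ := fun x => (σ (s x) : ℂ) * P x
  let G : Fin 2 → Plane → ℂ := fun i x =>
    ((2 * k (s x) * (x - c) i : ℝ) : ℂ) + Complex.I * (A x (e i) : ℂ) * (σ (s x) : ℂ)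
  let g : Fin 2 → Plane → ℂ := fun i x => G i x * P x
  have hGc : ∀ i, ContinuousOn (G i) (closure Ω) := by
    intro i
    have h1 : Continuous fun x : Plane => (x - c) i := by fun_prop
    have h2 : ContinuousOn (fun x => A x (e i)) (closure Ω) := hA.clm_apply continuousOn_const
    refine ContinuousOn.add (Continuous.continuousOn ?_) (ContinuousOn.mul
      (continuousOn_const.mul (Complex.continuous_ofReal.comp_continuousOn h2))
      (Continuous.continuousOn ?_))
    · exact Complex.continuous_ofReal.comp
        ((continuous_const.mul (hk.comp hsc)).mul h1)
    · exact Complex.continuous_ofReal.comp (hσc.comp hsc)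
  have hu0 : ∀ x ∈ Metric.ball c r₀, u x = 0 := fun x hx => by
    simp [u, (hlow _ (hs_ball x hx)).1]
  have hG0 : ∀ i, ∀ x ∈ Metric.ball c r₀, G i x = 0 := fun i x hx => by
    simp [G, (hlow _ (hs_ball x hx)).1, (hlow _ (hs_ball x hx)).2]
  have huc : ContinuousOn u Ω := hcontP _
    (Complex.continuous_ofReal.comp (hσc.comp hsc)).continuousOn fun x hx => by
      simp [(hlow _ (hs_ball x hx)).1]
  have hgc : ∀ i, ContinuousOn (g i) Ω := fun i =>
    hcontP _ ((hGc i).mono subset_closure) (hG0 i)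
  have hline : ∀ i, ∀ x ∈ Ω, HasLineDerivAt ℝ u (g i x) x (e i) := by
    intro i x hx
    by_cases hxb : x ∈ Metric.ball c r₀
    · have h1 : HasFDerivAt u (0 : Plane →L[ℝ] ℂ) x := by
        refine (hasFDerivAt_const (0 : ℂ) x).congr_of_eventuallyEq ?_
        filter_upwards [Metric.isOpen_ball.mem_nhds hxb] with y hy using hu0 y hy
      have h2 := h1.hasLineDerivAt (e i)
      have h3 : g i x = 0 := by simp only [g, hG0 i x hxb, zero_mul]
      rw [h3]
      simpa using h2
    · have hψx := (hψ x (hnear x hx hxb)).hasLineDerivAt (e i)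
      have hsx : HasLineDerivAt ℝ s (2 * (x - c) i) x (e i) := by
        have h1 := (((hasFDerivAt_id x).sub_const c).norm_sq).hasLineDerivAt (e i)
        have h2 : ∀ y : Plane, inner ℝ y (e i) = y i := fun y => by
          simp [e, EuclideanSpace.inner_single_right]
        simpa [h2] using h1
      unfold HasLineDerivAt at hψx hsx ⊢
      have hσx : HasDerivAt (fun t : ℝ => σ (s (x + t • e i)))
          (k (s x) * (2 * (x - c) i)) 0 := by
        refine HasDerivAt.comp (h := fun t : ℝ => s (x + t • e i)) (h₂ := σ) 0 ?_ hsx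
        simpa using hσ (s x)
      have hP := (hψx.ofReal_comp.mul_const Complex.I).cexp
      have hprod := hσx.ofReal_comp.mul hP
      refine hprod.congr_deriv ?_
      simp only [zero_smul, add_zero, g, G, P]
      push_cast
      ring
  have hfin : IsFiniteMeasure (volume.restrict Ω) :=
    ⟨by rw [Measure.restrict_apply_univ]; exact hΩb.measure_lt_top⟩
  have hun : ∀ x, ‖u x‖ = σ (s x) := fun x => by
    simp only [u, norm_mul, hPn, mul_one, Complex.norm_real, Real.norm_eq_abs,
      abs_of_nonneg (h01 _).1]
  have hu2 : MemLp u 2 (volume.restrict Ω) :=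
    MemLp.of_bound (huc.aestronglyMeasurable hΩ.measurableSet) 1
      (Eventually.of_forall fun x => (hun x).trans_le (h01 _).2)
  have hH1 : IsH1WithGradient Ω u g := by
    refine ⟨hu2, fun i =>
      ⟨?_, isWeakPartial_of_hasLineDerivAt huc (hgc i) hΩ (hline i)⟩⟩
    -- Continuity of `A` up to the boundary bounds the gradient, which makes it square integrable.
    obtain ⟨C, hC⟩ := (hΩb.isCompact_closure).exists_bound_of_continuousOn (hGc i)
    refine MemLp.of_bound ((hgc i).aestronglyMeasurable hΩ.measurableSet) C ?_
    filter_upwards [ae_restrict_mem hΩ.measurableSet] with x hx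
    simp only [g, norm_mul, hPn, mul_one]
    exact hC x (subset_closure hx)
  have henergy : magneticEnergy Ω A u g ≤ 6 * Real.pi / ℓ := by
    have h1 : ∀ x, ∑ i, ‖g i x - Complex.I * (A x (e i) : ℂ) * u x‖ ^ 2 =
        4 * ‖x - c‖ ^ 2 * k (‖x - c‖ ^ 2) ^ 2 := by
      intro x
      -- The derivative of the phase cancels the potential, leaving only the gradient of the
      -- cut-off.
      have h2 : ∀ i, g i x - Complex.I * (A x (e i) : ℂ) * u x =
          ((2 * k (s x) * (x - c) i : ℝ) : ℂ) * P x := fun i => by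
        simp only [g, G, u]; ring
      simp only [h2, norm_mul, hPn, mul_one, Complex.norm_real, Fin.sum_univ_two, mul_pow,
        Real.norm_eq_abs, sq_abs]
      have h3 : ‖x - c‖ ^ 2 = (x - c) 0 ^ 2 + (x - c) 1 ^ 2 := by
        rw [EuclideanSpace.real_norm_sq_eq, Fin.sum_univ_two]
      have h4 : s x = ‖x - c‖ ^ 2 := rfl
      rw [← h4]
      have h5 : s x = (x - c) 0 ^ 2 + (x - c) 1 ^ 2 := h3
      linear_combination (-4 * k (s x) ^ 2) * h5
    have hcont : Continuous fun x : Plane => 4 * ‖x - c‖ ^ 2 * k (‖x - c‖ ^ 2) ^ 2 := by fun_prop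
    have hint : Integrable fun x : Plane => 4 * ‖x - c‖ ^ 2 * k (‖x - c‖ ^ 2) ^ 2 := by
      refine hcont.integrable_of_hasCompactSupport
        (HasCompactSupport.intro (isCompact_closedBall c 1) fun x hx => ?_)
      have hx1 : 1 < ‖x - c‖ := by
        rw [← dist_eq_norm]; simpa using hx
      have : Real.exp (-ℓ) ≤ ‖x - c‖ ^ 2 := by
        have : Real.exp (-ℓ) ≤ 1 := Real.exp_le_one_iff.2 (by linarith)
        nlinarith
      rw [hkhi _ this]
      ring
    simp only [magneticEnergy, h1]
    refine (setIntegral_le_integral hint (Eventually.of_forall fun x => by positivity)).trans ?_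
    rw [integral_radial (fun y => 4 * y ^ 2 * k (y ^ 2) ^ 2) c, hen]
    apply le_of_eq
    ring
  have harea0 : 0 < area Ω := by
    have := mul_pos Real.pi_pos (Real.exp_pos (-ℓ))
    linarith
  have hmass : 3 / 4 * area Ω ≤ ∫ x in Ω, ‖u x‖ ^ 2 := by
    -- Outside the disc of radius `r₁` the test function has modulus one. That disc has area `π exp
    -- (-ℓ)`, at most a quarter of the area of `Ω` by `harea`.
    set r₁ := Real.exp (-(1 / 2 * ℓ)) with hr₁
    have hr₁0 : 0 < r₁ := Real.exp_pos _
    have hr₁s : r₁ ^ 2 = Real.exp (-ℓ) := by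
      rw [hr₁, ← Real.exp_nat_mul]; congr 1; push_cast; ring
    have hint : IntegrableOn (fun x => ‖u x‖ ^ 2) Ω :=
      hu2.integrable_norm_pow (p := 2) two_ne_zero
    have h1 : ∫ x in Ω \ Metric.ball c r₁, ‖u x‖ ^ 2 ≤ ∫ x in Ω, ‖u x‖ ^ 2 :=
      setIntegral_mono_set hint (Eventually.of_forall fun x => by positivity)
        (LE.le.eventuallyLE Set.sdiff_subset)
    have h2 : ∫ x in Ω \ Metric.ball c r₁, ‖u x‖ ^ 2 = volume.real (Ω \ Metric.ball c r₁) := by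
      rw [setIntegral_congr_fun (g := fun _ => (1 : ℝ))
        (hΩ.measurableSet.diff measurableSet_ball)]
      · simp
      · intro x hx
        have hx1 : r₁ ≤ ‖x - c‖ := by
          rw [← dist_eq_norm]; simpa using hx.2
        have : σ (s x) = 1 := hhi _ (hr₁s ▸ pow_le_pow_left₀ hr₁0.le hx1 2)
        simp only [hun, this, one_pow]
    have h3 : area Ω ≤ volume.real (Ω \ Metric.ball c r₁) + volume.real (Metric.ball c r₁) := by
      refine (measureReal_mono (μ := volume)
        (s₂ := Ω \ Metric.ball c r₁ ∪ Metric.ball c r₁) ?_ ?_).trans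
        (measureReal_union_le _ _)
      · intro x hx
        by_cases hb : x ∈ Metric.ball c r₁
        exacts [Or.inr hb, Or.inl ⟨hx, hb⟩]
      · exact ((hΩb.subset Set.sdiff_subset).union Metric.isBounded_ball).measure_lt_top.ne
    have h4 : volume.real (Metric.ball c r₁) = Real.exp (-ℓ) * Real.pi := by
      rw [Measure.real, EuclideanSpace.volume_ball_fin_two, ← ENNReal.ofReal_pow hr₁0.le,
        ENNReal.toReal_mul, ENNReal.toReal_ofReal (by positivity),
        ENNReal.toReal_ofReal Real.pi_pos.le, hr₁s]
    rw [h4] at h3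
    linarith
  have hmass0 : 0 < ∫ x in Ω, ‖u x‖ ^ 2 := by linarith
  have hmem : magneticEnergy Ω A u g / ∫ x in Ω, ‖u x‖ ^ 2 ∈ rayleighQuotients Ω A := by
    refine ⟨u, g, hH1, fun hu => ?_, rfl⟩
    have : ∫ x in Ω, ‖u x‖ ^ 2 = 0 := by
      rw [integral_congr_ae (g := fun _ => (0 : ℝ)), integral_zero]
      filter_upwards [hu] with x hx
      simp [hx]
    linarith
  refine (csInf_le ⟨0, fun r hr => rayleighQuotients_nonneg hr⟩ hmem).trans ?_
  rw [div_le_iff₀ hmass0]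
  refine henergy.trans ?_
  have h5 : 6 * Real.pi / ℓ = 8 * Real.pi / (area Ω * ℓ) * (3 / 4 * area Ω) := by
    field_simp; norm_num
  rw [h5]
  exact mul_le_mul_of_nonneg_left hmass (by have := Real.pi_pos; positivity)

lemma segment_subset_closedBall_midpoint (p q : Plane) :
    segment ℝ p q ⊆ Metric.closedBall (midpoint ℝ p q) (dist p q / 2) := by
  refine (convex_closedBall _ _).segment_subset ?_ ?_
  · rw [Metric.mem_closedBall, dist_left_midpoint]
    simp; linarith
  · rw [Metric.mem_closedBall, dist_right_midpoint]
    simp; linarith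

/-- The upper bound for the ground state energy of a doubly connected domain. -/
theorem IsDoublyConnectedDomain.groundState_le {Ω : Set Plane} (hΩ : IsDoublyConnectedDomain Ω)
    {A : Plane → (Plane →L[ℝ] ℝ)} (hA : IsClosedPotential Ω A)
    (hh : cheegerCut Ω ≤ min 1 (area Ω / (2 * Real.pi))) :
    groundState Ω A ≤ 8 * Real.pi / (area Ω * |Real.log (cheegerCut Ω / 2)|) := by
  obtain ⟨p, q, hpq, hsc, hcut, -, -⟩ := hΩ.exists_optimal_cut
  rw [hcut] at hh ⊢
  have hd : 0 < dist p q := dist_pos.2 hpq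
  obtain ⟨hh1, hh2⟩ := le_min_iff.1 hh
  have hlog : Real.log (dist p q / 2) < 0 := Real.log_neg (by positivity) (by linarith)
  -- The choice `ℓ = |log (h / 2)|` makes `exp (-ℓ)` the radius of the disc with the cut as
  -- diameter. The area condition then reads `π h / 2 ≤ |Ω| / 4`, which is `h ≤ |Ω| / (2π)`.
  have hexp : Real.exp (-|Real.log (dist p q / 2)|) = dist p q / 2 := by
    rw [abs_of_neg hlog, neg_neg, Real.exp_log (by positivity)]
  have hWo : IsOpen (Ω \ segment ℝ p q) :=
    hΩ.isOpen.sdiff (isCompact_segment_plane p q).isClosed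
  have hdiff : DifferentiableOn ℝ A (Ω \ segment ℝ p q) :=
    (hA.1.differentiableOn (by simp)).mono (Set.sdiff_subset.trans subset_closure)
  obtain ⟨ψ, hψ⟩ := exists_primitive_of_isSimplyConnected hWo hsc hdiff
    fun x hx => hA.2 x hx.1
  refine groundState_le_of_phase hΩ.isOpen hΩ.isBounded hA.1.continuousOn hψ
    (c := midpoint ℝ p q) (abs_pos.2 hlog.ne) ?_ ?_
  · rw [hexp]
    exact Set.sdiff_subset_sdiff_right (segment_subset_closedBall_midpoint p q)
  · rw [hexp]
    rw [le_div_iff₀ (by have := Real.pi_pos; positivity)] at hh2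
    linarith

lemma IsDoublyConnectedDomain.area_pos {Ω : Set Plane} (hΩ : IsDoublyConnectedDomain Ω) :
    0 < area Ω :=
  ENNReal.toReal_pos (hΩ.isOpen.measure_pos volume hΩ.isConnected.nonempty).ne'
    hΩ.isBounded.measure_lt_top.ne

end MagneticPlane

theorem corollary1 :
    (∀ Ω : Set MagneticPlane.Plane, MagneticPlane.IsDoublyConnectedDomain Ω →
      -- the minimum defining `h(Ω)` is attained, it is positive, and it is the minimal width
      (IsLeast (MagneticPlane.cutLengths Ω) (MagneticPlane.cheegerCut Ω) ∧
        0 < MagneticPlane.cheegerCut Ω ∧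
        MagneticPlane.cheegerCut Ω = MagneticPlane.minWidth Ω) ∧
      -- the eigenvalue bound
      (∀ A : MagneticPlane.Plane → (MagneticPlane.Plane →L[ℝ] ℝ),
        MagneticPlane.IsClosedPotential Ω A →
        MagneticPlane.cheegerCut Ω ≤ min 1 (MagneticPlane.area Ω / (2 * Real.pi)) →
        MagneticPlane.groundState Ω A ≤
          8 * Real.pi /
            (MagneticPlane.area Ω * |Real.log (MagneticPlane.cheegerCut Ω / 2)|))) ∧
    -- at fixed area, `λ₁` tends to zero as the boundary components approach each other
    (∀ (Ω : ℕ → Set MagneticPlane.Plane)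
      (A : ℕ → MagneticPlane.Plane → (MagneticPlane.Plane →L[ℝ] ℝ)) (a : ℝ),
      (∀ k, MagneticPlane.IsDoublyConnectedDomain (Ω k)) →
      (∀ k, MagneticPlane.IsClosedPotential (Ω k) (A k)) →
      (∀ k, MagneticPlane.area (Ω k) = a) →
      Tendsto (fun k => MagneticPlane.minWidth (Ω k)) atTop (𝓝 0) →
      Tendsto (fun k => MagneticPlane.groundState (Ω k) (A k)) atTop (𝓝 0)) := by
  have hcut : ∀ Ω : Set MagneticPlane.Plane, MagneticPlane.IsDoublyConnectedDomain Ω →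
      IsLeast (MagneticPlane.cutLengths Ω) (MagneticPlane.cheegerCut Ω) ∧
        0 < MagneticPlane.cheegerCut Ω ∧
        MagneticPlane.cheegerCut Ω = MagneticPlane.minWidth Ω := by
    intro Ω hΩ
    obtain ⟨p, q, hpq, -, h1, h2, h3⟩ := hΩ.exists_optimal_cut
    rw [h1, h2]
    exact ⟨h3, dist_pos.2 hpq, rfl⟩
  refine ⟨fun Ω hΩ => ⟨hcut Ω hΩ, fun A hA hh => hΩ.groundState_le hA hh⟩, ?_⟩
  intro Ω A a hΩ hA ha hw
  have ha0 : 0 < a := ha 0 ▸ (hΩ 0).area_pos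
  have hh : Tendsto (fun k => MagneticPlane.cheegerCut (Ω k)) atTop (𝓝[>] 0) := by
    refine tendsto_nhdsWithin_iff.2 ⟨?_, Eventually.of_forall fun k => (hcut _ (hΩ k)).2.1⟩
    simpa only [(hcut _ (hΩ _)).2.2] using hw
  have hlog : Tendsto (fun k => a * |Real.log (MagneticPlane.cheegerCut (Ω k) / 2)|)
      atTop atTop := by
    refine Tendsto.const_mul_atTop ha0 (tendsto_abs_atBot_atTop.comp ?_)
    refine Real.tendsto_log_nhdsGT_zero.comp (tendsto_nhdsWithin_iff.2 ⟨?_, ?_⟩)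
    · simpa using (hh.mono_right nhdsWithin_le_nhds).div_const 2
    · exact Eventually.of_forall fun k => half_pos (hcut _ (hΩ k)).2.1
  refine tendsto_of_tendsto_of_tendsto_of_le_of_le' tendsto_const_nhds
    (hlog.const_div_atTop (8 * Real.pi))
    (Eventually.of_forall fun k => MagneticPlane.groundState_nonneg _ _) ?_
  have hpos : 0 < min 1 (a / (2 * Real.pi)) :=
    lt_min one_pos (div_pos ha0 (mul_pos two_pos Real.pi_pos))
  -- The smallness condition for the bound holds eventually because its threshold depends only on
  -- the common area.
  filter_upwards [(hh.mono_right nhdsWithin_le_nhds).eventually_le_const hpos] with k hk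
  have := (hΩ k).groundState_le (hA k) (by rwa [ha k])
  rwa [ha k] at this
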